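/- Consider the deterministic $\mathsf{LOCAL}$ model: the network is a finite simple graph $G=(V,E)$ with $n=|V|$ nodes and maximum degree $\Delta$; nodes have unique identifiers that are natural numbers; all nodes run the same deterministic program; in each synchronous round every node sends a message of unbounded size to each of its neighbors, receives their messages, and performs an arbitrary local computation. Let $c\in\mathbb N$ and $a\ge 1$ be constants. The identifiers are smaller than some $N\le n^{c}$. Initially each node knows only its own identifier, $N$, and an estimate $\ell$ of $\log_2\Delta$ that is correct up to the constant factor $a$, i.e. $\log_2\Delta\le a\,\ell$ and $\ell\le a\log_2\Delta$ (with $\log_2 0:=0$). A node stops with an irrevocable output; an algorithm computes an edge set $M$ within $T$ rounds if after $T$ rounds every node has stopped, its output being the set of identifiers of those nodes to which it is joined by an edge of $M$. For $\varepsilon>0$, an $\varepsilon$-maximal matching of $G$ is a set $M\subseteq E$ of pairwise disjoint edges such that $|\Gamma^+(M)|\ge(1-\varepsilon)|E|$, where $\Gamma^+(M)=\{e\in E : \exists e'\in M,\ e\cap e'\neq\emptyset\}$. **Theorem.** There is a constant $C>0$, depending only on $a$ and $c$, such that for every $\varepsilon>0$ there is a deterministic $\mathsf{LOCAL}$ algorithm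 that computes, on every finite simple graph $G$ with identifiers, $N$ and $\ell$ as above, an $\varepsilon$-maximal matching $M$ within $T$ rounds for some $$T\;\le\; C\Bigl(\log_2^2\Delta\cdot\max\bigl(0,\lceil\log_2\tfrac1\varepsilon\rceil\bigr)+\log^* n\Bigr),$$ that is, in $O(\log^2\Delta\cdot\log\frac1\varepsilon+\log^* n)$ rounds. In particular, at most $\varepsilon|E|$ edges of $G$ have both endpoints unmatched by $M$. Here $\log^* n$ is the least $k\ge 0$ such that applying $\log_2$ $k$ times to $n$ gives a value at most $1$. -/

import Mathlib

/-- `logStar x` is the iterated logarithm `log* x`: the least number of times that the binary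
logarithm has to be applied to `x` to reach a value which is at most `1`. -/
noncomputable def logStar (x : ℝ) : ℕ :=
  sInf {k : ℕ | (Real.logb 2)^[k] x ≤ 1}

/-- What a node knows before the first round: its own identifier, a bound such that all identifiers
are smaller than it, and an estimate of the logarithm of the maximum degree. -/
structure NodeInput where
  ident : ℕ
  identBound : ℕ
  logDegreeEstimate : ℝ

/-- A deterministic algorithm in the `LOCAL` model. All nodes run the same program. In each round a
node sends to each of its neighbours a message that is a function of its own state and of the
identifier of that neighbour, and computes its new state from its old one and from the messages
received. Neither the message size nor the local computation is limited. A node stops as soon as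
`output` of its state is `some o`, and `o` is then its output. -/
structure LocalAlgorithm (Out : Type) where
  State : Type
  Msg : Type
  init : NodeInput → State
  send : State → ℕ → Msg
  receive : State → (ℕ → Option Msg) → State
  output : State → Option Out

namespace LocalAlgorithm

variable {Out : Type} {V : Type*}

open Classical in
/-- The messages that node `v` receives in a round when the states of the nodes are `σ`: the entry
at `i` is the message sent to `v` by its neighbour with identifier `i`, and `none` if `v` has no
neighbour with this identifier. Identifiers are unique, so there is at most one such neighbour. -/
noncomputable def inbox (A : LocalAlgorithm Out) (G : SimpleGraph V) (ident : V → ℕ)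
    (σ : V → A.State) (v : V) (i : ℕ) : Option A.Msg :=
  if h : ∃ u, G.Adj v u ∧ ident u = i then some (A.send (σ h.choose) (ident v)) else none

/-- The states of the nodes after `t` synchronous rounds on the graph `G` with identifiers `ident`.
The state of a node that has stopped does not change any more (its neighbours keep receiving the
messages determined by this last state), so that outputs are irrevocable. -/
noncomputable def stateAfter (A : LocalAlgorithm Out) (G : SimpleGraph V) (ident : V → ℕ)
    (N : ℕ) (ℓ : ℝ) : ℕ → V → A.State
  | 0, v => A.init ⟨ident v, N, ℓ⟩
  | t + 1, v =>
    match A.output (stateAfter A G ident N ℓ t v) with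
    | some _ => stateAfter A G ident N ℓ t v
    | none => A.receive (stateAfter A G ident N ℓ t v)
        (A.inbox G ident (stateAfter A G ident N ℓ t) v)

/-- After `T` rounds all nodes have stopped, and they have computed the edge set `M`: the output of
each node is the set of the identifiers of those nodes to which it is joined by an edge in `M`. -/
def ComputesEdgesWithin (A : LocalAlgorithm (Finset ℕ)) (G : SimpleGraph V) (ident : V → ℕ)
    (N : ℕ) (ℓ : ℝ) (T : ℕ) (M : Set (Sym2 V)) : Prop :=
  ∀ v, ∃ out : Finset ℕ, A.output (A.stateAfter G ident N ℓ T v) = some out ∧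
    ∀ i, i ∈ out ↔ ∃ u, s(v, u) ∈ M ∧ ident u = i

end LocalAlgorithm

/-- `M` is an (integral) matching of `G`: a set of pairwise disjoint edges. -/
def IsEdgeMatching {V : Type*} (G : SimpleGraph V) (M : Set (Sym2 V)) : Prop :=
  M ⊆ G.edgeSet ∧ ∀ e ∈ M, ∀ e' ∈ M, e ≠ e' → ∀ v, ¬ (v ∈ e ∧ v ∈ e')

/-- `Γ⁺(M)`: the edges of `G` that share an endpoint with an edge in `M` (those in `M` included). -/
def coveredEdges {V : Type*} (G : SimpleGraph V) (M : Set (Sym2 V)) : Set (Sym2 V) :=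
  {e ∈ G.edgeSet | ∃ e' ∈ M, ∃ v, v ∈ e ∧ v ∈ e'}

/-- `M` is an `ε`-maximal matching of the finite graph `G`: a matching with
`|Γ⁺(M)| ≥ (1 - ε) |E|`. -/
def IsEpsMaximalMatching {V : Type*} (G : SimpleGraph V) (ε : ℝ) (M : Set (Sym2 V)) : Prop :=
  IsEdgeMatching G M ∧ (1 - ε) * (G.edgeSet.ncard : ℝ) ≤ ((coveredEdges G M).ncard : ℝ)

/-- The edges of `G` both of whose endpoints are left unmatched by `M`. -/
def unmatchedEdges {V : Type*} (G : SimpleGraph V) (M : Set (Sym2 V)) : Set (Sym2 V) :=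
  {e ∈ G.edgeSet | ∀ v ∈ e, ∀ e' ∈ M, v ∉ e'}

-- One phase of O(log² Δ) rounds finds a matching that covers at least 1/16 of the edges. Deleting
-- the matched nodes and repeating this 11⌈log₂(1/ε)⌉ times leaves at most ε|E| edges uncovered,
-- because (15/16)^11 < 1/2.
--
-- In a phase, every edge is directed from larger to smaller degree and gets the value 2^(-⌈log₂
-- deg⌉) for the degree of its tail. The values leaving a node, and those entering it, then sum to
-- at most 1, while the values weighted by the degree of the tail sum to a constant fraction of |E|.
-- With K ≈ log Δ, a sequence of K roundings doubles or erases the smallest values and preserves the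
-- bounds at the nodes, until all values are 1: the surviving arcs form directed paths and cycles
-- (`size_le_sum_pathArcs`). Degrees do not increase along them, so a greedy matching on them
-- touches nodes of large total degree (`sum_le_two_mul_sum_touched`), and this total bounds the
-- number of edges removed (`size_prune_add_le`).
--
-- A rounding pairs arcs at their tails and at their heads and has to select alternate arcs on the
-- resulting walks. Long walks cannot be treated exactly in few rounds. Instead each pair at a tail
-- selects the arc from which the smaller label is visible within r steps. Two arcs paired at a head
-- are both selected only around a minimum of a whole window of labels; the one with the smaller
-- label is then dropped. Labels are ordered by weight, so a loss is charged to a window of r + 1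
-- arcs of at least the same weight (`PathRounding.sum_kept`). With r = 4K, all K roundings together
-- lose at most half of the weight.
--
-- The log* n term is paid once, for a colouring of the whole graph with 2^O(log Δ) binary digits
-- per colour; each phase reduces these colours to ten digits on its paths in O(log Δ) rounds.
-- Locality is treated as invariance under the bisimulation `Sim`, and `exists_algorithm` turns any
-- invariant function into an algorithm.

universe u

/-! ### Approximate alternating selection along the walks of two involutions -/

namespace PathRounding

variable {α Λ : Type*} [LinearOrder Λ] (L R : α → α) (lab : α → Λ) (r : ℕ)

/-- One step of the walk that alternates between the two pairings. -/
def step (e : α) : α := L (R e)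

/-- The least label on the next `r` steps of the walk from `e`, with the time when it is met. -/
noncomputable def best (e : α) : Λ ×ₗ ℕ :=
  (Finset.range (r + 1)).inf' ⟨0, by simp⟩ fun t => toLex (lab ((step L R)^[t] e), t)

/-- `e` is preferred to its `L`-partner. -/
def Oriented (e : α) : Prop := L e = e ∨ best L R lab r e < best L R lab r (L e)

/-- `e` is preferred to its `L`-partner, and survives a conflict with its `R`-partner. -/
def Kept (e : α) : Prop :=
  Oriented L R lab r e ∧ (R e = e ∨ ¬ Oriented L R lab r (R e) ∨ lab (R e) < lab e)

/-- `e` loses a conflict with its `R`-partner. -/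
def Dropped (e : α) : Prop :=
  Oriented L R lab r e ∧ Oriented L R lab r (R e) ∧ R e ≠ e ∧ lab e < lab (R e)

variable {L R lab r}

theorem best_le {e : α} {t : ℕ} (ht : t ≤ r) :
    best L R lab r e ≤ toLex (lab ((step L R)^[t] e), t) :=
  Finset.inf'_le _ (by simpa [Nat.lt_succ_iff] using ht)

theorem exists_best (e : α) :
    ∃ t ≤ r, best L R lab r e = toLex (lab ((step L R)^[t] e), t) := by
  obtain ⟨t, ht, h⟩ := Finset.exists_mem_eq_inf' (s := Finset.range (r + 1)) ⟨0, by simp⟩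
    fun t => (toLex (lab ((step L R)^[t] e), t) : Λ ×ₗ ℕ)
  exact ⟨t, by simpa [Nat.lt_succ_iff] using ht, h⟩

theorem fst_le_of_lex {β : Type*} [LinearOrder β] {a b : Λ} {i j : β}
    (h : (toLex (a, i) : Λ ×ₗ β) ≤ toLex (b, j)) : a ≤ b := by
  rcases Prod.Lex.toLex_le_toLex.1 h with h | h
  · exact h.le
  · exact h.1.le

/-- One step further on, the same label is met one time unit earlier. This is why `best` records the
time. -/
theorem best_step_lt {e : α} {t : ℕ} (ht : t + 1 ≤ r)
    (h : best L R lab r e = toLex (lab ((step L R)^[t + 1] e), t + 1)) :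
    best L R lab r (L (R e)) < best L R lab r e := by
  refine (best_le (t := t) (by omega)).trans_lt ?_
  rw [h, Prod.Lex.toLex_lt_toLex]
  right
  exact ⟨rfl, Nat.lt_succ_self t⟩

theorem Oriented.best_le {e : α} (h : Oriented L R lab r e) :
    best L R lab r e ≤ best L R lab r (L e) := by
  rcases h with h | h
  · rw [h]
  · exact h.le

/-- The walk from `L e` is the image under `L` of the walk from `e` run backwards. -/
theorem iterate_step_reverse (hL : Function.Involutive L) (hR : Function.Involutive R) (t : ℕ)
    (e : α) : (step L R)^[t] (L ((step L R)^[t] e)) = L e := by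
  induction t with
  | zero => rfl
  | succ t ih =>
    rw [Function.iterate_succ_apply' _ t e, Function.iterate_succ_apply]
    have : step L R (L (step L R ((step L R)^[t] e))) = L ((step L R)^[t] e) := by
      simp only [step]
      rw [hL, hR]
    rw [this, ih]

theorem step_injective (hL : Function.Involutive L) (hR : Function.Involutive R) :
    Function.Injective (step L R) :=
  hL.injective.comp hR.injective

/-- If the optimum for `e` lay at a positive time, `R e`, being oriented, would have a strictly
smaller optimum. At time 0 this contradicts `lab e < lab (R e)`; later it makes the optimum of `L e`
smaller still, against the orientation of `e`. Hence a dropped element has the least label in its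
windows in both directions. -/
theorem Dropped.best_eq (hR : Function.Involutive R) {e : α} (h : Dropped L R lab r e) :
    best L R lab r e = toLex (lab e, 0) := by
  obtain ⟨h1, h2, -, h4⟩ := h
  obtain ⟨t, ht, hb⟩ := exists_best (L := L) (R := R) (lab := lab) (r := r) e
  rcases t with _ | t
  · exact hb
  exfalso
  have h5 := best_step_lt ht hb
  have h6 := h2.best_le.trans_lt h5
  obtain ⟨t', ht', hb'⟩ := exists_best (L := L) (R := R) (lab := lab) (r := r) (R e)
  rcases t' with _ | t'
  · have h7 : best L R lab r e ≤ toLex (lab e, 0) := best_le (t := 0) (Nat.zero_le _)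
    have := hb' ▸ (h6.le.trans h7)
    exact absurd (fst_le_of_lex this) (not_le.2 h4)
  · have h7 := best_step_lt ht' hb'
    rw [hR] at h7
    exact absurd (h7.trans h6) (not_lt.2 h1.best_le)

theorem Dropped.lab_le (hR : Function.Involutive R) {e : α} (h : Dropped L R lab r e) {t : ℕ}
    (ht : t ≤ r) : lab e ≤ lab ((step L R)^[t] e) :=
  fst_le_of_lex ((h.best_eq hR) ▸ best_le ht)

theorem Dropped.lab_le_reverse (hR : Function.Involutive R) {e : α} (h : Dropped L R lab r e)
    {t : ℕ} (ht : t ≤ r) : lab e ≤ lab ((step L R)^[t] (L e)) :=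
  fst_le_of_lex ((h.best_eq hR) ▸ h.1.best_le.trans (best_le ht))

/-- The walk from `L (R e)` returns to `e`, so the oriented element `R e` must see a label at most
`lab e` as well, and not at time 0. Its next element is `L e`, where the backward window starts, and
there only `e` itself has so small a label. -/
theorem Dropped.reflects (hR : Function.Involutive R) (hlab : Function.Injective lab) {e : α}
    (h : Dropped L R lab r e) {p : ℕ} (hp : p + 1 ≤ r) (hpe : (step L R)^[p + 1] e = e) :
    ∃ t, (step L R)^[t] (L e) = e := by
  have h1 : best L R lab r (L (R e)) ≤ toLex (lab ((step L R)^[p] (L (R e))), p) :=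
    PathRounding.best_le (by omega)
  have h2 : (step L R)^[p] (L (R e)) = e := by
    rw [← hpe]
    conv_rhs => rw [Function.iterate_succ_apply]
    rw [hpe]; rfl
  obtain ⟨t, ht, hb⟩ := exists_best (L := L) (R := R) (lab := lab) (r := r) (R e)
  rw [h2] at h1
  have h3 := hb ▸ h.2.1.best_le.trans h1
  have h4 := fst_le_of_lex h3
  rcases t with _ | t
  · exact absurd h4 (not_le.2 h.2.2.2)
  · have h5 : (step L R)^[t + 1] (R e) = (step L R)^[t] (L e) := by
      rw [Function.iterate_succ_apply]
      simp only [step]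
      rw [hR]
    rw [h5] at h4
    exact ⟨t, hlab (le_antisymm h4 (h.lab_le_reverse hR (by omega)))⟩

/-- Both elements are minima of their windows, and the backward window of `e'` contains `L e`, so
`lab e'` lies between `lab e` and `lab (L e)`. Only `e` and `L e` have labels there, and they cannot
both be oriented unless they coincide. -/
theorem Dropped.eq_of_mem_window (hL : Function.Involutive L) (hR : Function.Involutive R)
    (hflag : ∀ x y, R x = x → R y ≠ y → lab x < lab y)
    (hcons : ∀ x y, R x ≠ x → R (L x) ≠ L x → lab x ≤ lab y → lab y ≤ lab (L x) → y = x ∨ y = L x)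
    {e e' : α} (h : Dropped L R lab r e) (h' : Dropped L R lab r e') {t : ℕ} (ht : t ≤ r)
    (he : (step L R)^[t] e = e') : e = e' := by
  have h1 := h.lab_le hR ht
  have h2 := h'.lab_le_reverse hR ht
  rw [← he, iterate_step_reverse hL hR, he] at h2
  rw [he] at h1
  have h3 : R (L e) ≠ L e := fun h3 =>
    absurd (hflag _ _ h3 h.2.2.1) (not_lt.2 (h.lab_le_reverse hR (Nat.zero_le _)))
  rcases hcons e e' h.2.2.1 h3 h1 h2 with h4 | h4
  · exact h4.symm
  · subst h4
    rcases h.1 with h5 | h5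
    · exact h5.symm
    · rcases h'.1 with h6 | h6
      · rw [hL] at h6; exact h6
      · rw [hL] at h6; exact absurd (h5.trans h6) (lt_irrefl _)

/-- A short walk that comes back to a dropped element visits two fixed points of `L`. -/
theorem Dropped.exists_fixed (hL : Function.Involutive L) (hR : Function.Involutive R)
    (hlab : Function.Injective lab) (hflag : ∀ x y, R x = x → R y ≠ y → lab x < lab y)
    {e : α} (h : Dropped L R lab r e) {q : ℕ} (hq : q + 1 ≤ r) (hqe : (step L R)^[q + 1] e = e) :
    (∀ n, lab e ≤ lab ((step L R)^[n] e)) ∧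
    ∃ i j, (step L R)^[i] e ≠ (step L R)^[j] e ∧ L ((step L R)^[i] e) = (step L R)^[i] e ∧
      L ((step L R)^[j] e) = (step L R)^[j] e := by
  have hinj := step_injective hL hR
  set s := step L R with hs
  set p := Function.minimalPeriod s e with hp
  have hper : Function.IsPeriodicPt s (q + 1) e := hqe
  have hp0 : 0 < p := hper.minimalPeriod_pos (by omega)
  have hpr : p ≤ q + 1 := hper.minimalPeriod_le (by omega)
  have hpe : s^[p] e = e := Function.iterate_minimalPeriod
  have hle : ∀ n, lab e ≤ lab (s^[n] e) := fun n => by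
    rw [← Function.iterate_mod_minimalPeriod_eq]
    exact h.lab_le hR ((Nat.mod_lt _ hp0).le.trans (hpr.trans hq))
  have hfree : ∀ n, R (s^[n] e) ≠ s^[n] e := fun n hn =>
    absurd (hflag _ _ hn h.2.2.1) (not_lt.2 (hle n))
  -- The walk from `e` to `L e` is its own mirror image. With an odd number of steps its midpoint
  -- would be fixed by `R`, but by `hflag` such labels lie below the minimum `lab e`. With an even
  -- number the midpoint is fixed by `L`.
  have heven : ∀ c, s^[c] e = L e → Even c := by
    intro c hc
    by_contra hodd
    obtain ⟨k, rfl⟩ := Nat.not_even_iff_odd.1 hodd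
    refine hfree k ?_
    have h1 : s^[k + 1] (L (s^[k + 1] e)) = s^[k + 1] (s^[k] e) := by
      rw [← Function.iterate_add_apply s (k + 1) k, show (k + 1) + k = 2 * k + 1 by ring, hc]
      exact iterate_step_reverse hL hR (k + 1) e
    have h2 := hinj.iterate _ h1
    rw [Function.iterate_succ_apply', hs] at h2
    change L (L (R _)) = _ at h2
    rwa [hL] at h2
  have hfix : ∀ k, s^[k + k] e = L e → L (s^[k] e) = s^[k] e := by
    intro k hk
    have h1 := iterate_step_reverse hL hR k e
    rw [← hs, ← hk, Function.iterate_add_apply] at h1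
    exact hinj.iterate _ h1
  obtain ⟨t, ht⟩ := h.reflects hR hlab hq hqe
  have hmul : s^[p * t] e = e := by
    rw [Function.iterate_mul]
    exact Function.iterate_fixed hpe t
  have hc : s^[p * t - t] e = L e := by
    refine hinj.iterate t ?_
    rw [← Function.iterate_add_apply, ht, Nat.add_sub_cancel' (Nat.le_mul_of_pos_left t hp0), hmul]
  -- Meeting `L e` again a period later gives a second midpoint. The two midpoints are half a period
  -- apart and therefore distinct.
  have hc' : s^[(p * t - t) + p] e = L e := by
    rw [Function.iterate_add_apply, hpe, hc]
  refine ⟨hle, ?_⟩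
  obtain ⟨i, hi⟩ := heven _ hc
  obtain ⟨j, hj⟩ := heven _ hc'
  refine ⟨i, j, ?_, hfix i (hi ▸ hc), hfix j (hj ▸ hc')⟩
  intro hij
  have hji : j = i + (j - i) := by omega
  rw [hji, Function.iterate_add_apply] at hij
  have h3 := hinj.iterate _ hij
  have h4 : Function.IsPeriodicPt s (j - i) e := h3.symm
  have h5 := h4.minimalPeriod_le (by omega)
  omega

variable [Fintype α]

-- Exactly one element of each proper `L`-pair is oriented: equal optima at equal times would force
-- `e = L e` by injectivity. Each fixed point is oriented too and yields a surplus of half its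
-- weight, which later pays for dropped elements on closed walks.
open Classical in
theorem two_mul_sum_oriented (hL : Function.Involutive L) (hR : Function.Involutive R)
    (hlab : Function.Injective lab) (w : α → ℕ) (hwL : ∀ e, w (L e) = w e) :
    2 * ∑ e with Oriented L R lab r e, w e = ∑ e, w e + ∑ e with L e = e, w e := by
  have h1 : ∑ e with Oriented L R lab r e, w e = ∑ e with Oriented L R lab r (L e), w e := by
    rw [Finset.sum_filter, Finset.sum_filter]
    rw [← Equiv.sum_comp hL.toPerm]
    refine Finset.sum_congr rfl fun e _ => ?_
    simp [hwL]
  rw [two_mul]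
  nth_rewrite 2 [h1]
  rw [Finset.sum_filter, Finset.sum_filter, Finset.sum_filter, ← Finset.sum_add_distrib,
    ← Finset.sum_add_distrib]
  refine Finset.sum_congr rfl fun e _ => ?_
  by_cases h : L e = e
  · simp [h, Oriented]
  · have h' : L (L e) ≠ L e := fun h2 => h (hL.injective h2)
    have hne : best L R lab r e ≠ best L R lab r (L e) := by
      intro heq
      obtain ⟨t, ht, hb⟩ := exists_best (L := L) (R := R) (lab := lab) (r := r) e
      obtain ⟨t', ht', hb'⟩ := exists_best (L := L) (R := R) (lab := lab) (r := r) (L e)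
      rw [hb, hb'] at heq
      have h3 := toLex.injective heq
      simp only [Prod.mk.injEq] at h3
      obtain ⟨h3, rfl⟩ := h3
      exact h ((step_injective hL hR).iterate t (hlab h3)).symm
    have h'' : ¬ e = L e := fun h2 => h h2.symm
    simp only [Oriented, h, h'', false_or, hL e]
    rcases lt_or_gt_of_ne hne with h4 | h4
    · simp [h4, h4.not_gt]
    · simp [h4, h4.not_gt]

open Classical in
/-- The kept elements have almost half of the total weight. -/
theorem sum_kept (hL : Function.Involutive L) (hR : Function.Involutive R)
    (hlab : Function.Injective lab) (hflag : ∀ x y, R x = x → R y ≠ y → lab x < lab y)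
    (hcons : ∀ x y, R x ≠ x → R (L x) ≠ L x → lab x ≤ lab y → lab y ≤ lab (L x) → y = x ∨ y = L x)
    (w : α → ℕ) (hwL : ∀ e, w (L e) = w e)
    (hw : ∀ x y, R x ≠ x → R y ≠ y → lab x ≤ lab y → w x ≤ w y) :
    (r + 1) * ∑ e, w e ≤ 2 * (r + 1) * ∑ e with Kept L R lab r e, w e + 2 * ∑ e, w e := by
  have hinj := step_injective hL hR
  -- Dropped elements are separated according to whether their walk returns within `r` steps.
  -- Without a return, the window consists of `r + 1` different elements that can be charged.
  set A : Finset α := {e | Dropped L R lab r e ∧ ∀ p, p + 1 ≤ r → (step L R)^[p + 1] e ≠ e} with hA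
  set C : Finset α := {e | Dropped L R lab r e ∧ ∃ p, p + 1 ≤ r ∧ (step L R)^[p + 1] e = e} with hC
  have hsplit : ∑ e with Oriented L R lab r e, w e
      = ∑ e with Kept L R lab r e, w e + (∑ e ∈ A, w e + ∑ e ∈ C, w e) := by
    have hAC : ∑ e ∈ A, w e + ∑ e ∈ C, w e = ∑ e with Dropped L R lab r e, w e := by
      rw [← Finset.sum_union]
      · refine Finset.sum_congr ?_ fun _ _ => rfl
        ext e
        simp only [hA, hC, Finset.mem_union, Finset.mem_filter, Finset.mem_univ, true_and]
        grind
      · rw [Finset.disjoint_left]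
        intro e h1 h2
        simp only [hA, hC, Finset.mem_filter, Finset.mem_univ, true_and] at h1 h2
        grind
    rw [hAC, ← Finset.sum_union]
    · refine Finset.sum_congr ?_ fun _ _ => rfl
      ext e
      simp only [Finset.mem_union, Finset.mem_filter, Finset.mem_univ, true_and]
      simp only [Kept, Dropped]
      constructor
      · intro h
        by_cases h1 : R e = e
        · exact Or.inl ⟨h, Or.inl h1⟩
        by_cases h2 : Oriented L R lab r (R e)
        · rcases lt_or_gt_of_ne (fun h3 => h1 (hlab h3)) with h3 | h3
          · exact Or.inl ⟨h, Or.inr (Or.inr h3)⟩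
          · exact Or.inr ⟨h, h2, h1, h3⟩
        · exact Or.inl ⟨h, Or.inr (Or.inl h2)⟩
      · rintro (h | h)
        · exact h.1
        · exact h.1
    · rw [Finset.disjoint_left]
      intro e h1 h2
      simp only [Finset.mem_filter, Finset.mem_univ, true_and] at h1 h2
      simp only [Kept, Dropped] at h1 h2
      rcases h1.2 with h | h | h
      · exact h2.2.2.1 h
      · exact h h2.2.1
      · exact absurd h h2.2.2.2.not_gt
  -- Each element of `A` charges its window, whose members weigh at least as much; by
  -- `Dropped.eq_of_mem_window` no element is charged twice.
  have hsumA : (r + 1) * ∑ e ∈ A, w e ≤ ∑ e, w e := by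
    have h1 : (r + 1) * ∑ e ∈ A, w e
        ≤ ∑ x ∈ A ×ˢ Finset.range (r + 1), w ((step L R)^[x.2] x.1) := by
      rw [Finset.sum_product, Finset.mul_sum]
      refine Finset.sum_le_sum fun e he => ?_
      simp only [hA, Finset.mem_filter, Finset.mem_univ, true_and] at he
      rw [← smul_eq_mul, ← Finset.card_range (r + 1)]
      rw [Finset.card_range]
      conv_lhs => rw [← Finset.card_range (r + 1)]
      refine Finset.card_nsmul_le_sum _ _ _ fun t ht => ?_
      have ht' : t ≤ r := by simpa [Nat.lt_succ_iff] using ht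
      have h2 := he.1.lab_le hR ht'
      exact hw _ _ he.1.2.2.1 (fun h3 => absurd (hflag _ _ h3 he.1.2.2.1) (not_lt.2 h2)) h2
    refine h1.trans ?_
    rw [← Finset.sum_image (f := w) (g := fun x : α × ℕ => (step L R)^[x.2] x.1)]
    · exact Finset.sum_le_sum_of_subset (Finset.subset_univ _)
    · have key : ∀ (e e' : α) (i j : ℕ), e ∈ A → e' ∈ A → i ≤ r → j ≤ i →
          (step L R)^[i] e = (step L R)^[j] e' → e = e' ∧ i = j := by
        intro e e' i j he he' hi hj h
        simp only [hA, Finset.mem_filter, Finset.mem_univ, true_and] at he he'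
        obtain ⟨m, rfl⟩ := Nat.exists_eq_add_of_le hj
        rw [Function.iterate_add_apply] at h
        have h2 := hinj.iterate _ h
        have h3 := Dropped.eq_of_mem_window hL hR hflag hcons he.1 he'.1 (by omega) h2
        refine ⟨h3, ?_⟩
        rcases m with _ | m
        · rfl
        · exact absurd (h2.trans h3.symm) (he.2 m (by omega))
      rintro ⟨e, i⟩ h1 ⟨e', j⟩ h2 h
      simp only [Finset.coe_product, Finset.coe_range, Set.mem_prod, Finset.mem_coe,
        Set.mem_Iio] at h1 h2
      rcases le_total j i with hij | hij
      · obtain ⟨h3, h4⟩ := key e e' i j h1.1 h2.1 (by omega) hij h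
        rw [h3, h4]
      · obtain ⟨h3, h4⟩ := key e' e j i h2.1 h1.1 (by omega) hij h.symm
        rw [h3, h4]
  -- On a closed walk the loss is charged to two fixed points of `L`. No other element of `C` uses
  -- them, since each has the least label of its closed walk.
  have hsumC : 2 * ∑ e ∈ C, w e ≤ ∑ e with L e = e, w e := by
    have hex : ∀ e, ∃ ij : Bool → ℕ, e ∈ C → (∀ n, lab e ≤ lab ((step L R)^[n] e)) ∧
        (step L R)^[ij false] e ≠ (step L R)^[ij true] e ∧
        ∀ b, L ((step L R)^[ij b] e) = (step L R)^[ij b] e := by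
      intro e
      by_cases he : e ∈ C
      · have he' := he
        simp only [hC, Finset.mem_filter, Finset.mem_univ, true_and] at he'
        obtain ⟨hd, p, hp, hpe⟩ := he'
        obtain ⟨h1, i, j, h2, h3, h4⟩ := hd.exists_fixed hL hR hlab hflag hp hpe
        exact ⟨fun b => bif b then j else i, fun _ => ⟨h1, h2, by rintro (_ | _) <;> assumption⟩⟩
      · exact ⟨fun _ => 0, fun h => absurd h he⟩
    choose ij hij using hex
    have h1 : 2 * ∑ e ∈ C, w e
        ≤ ∑ x ∈ C ×ˢ (Finset.univ : Finset Bool), w ((step L R)^[ij x.1 x.2] x.1) := by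
      rw [Finset.sum_product, Finset.mul_sum]
      refine Finset.sum_le_sum fun e he => ?_
      obtain ⟨h1, -, -⟩ := hij e he
      have hd : Dropped L R lab r e := by
        simp only [hC, Finset.mem_filter, Finset.mem_univ, true_and] at he
        exact he.1
      have h2 : ∀ n, w e ≤ w ((step L R)^[n] e) := fun n =>
        hw _ _ hd.2.2.1 (fun h3 => absurd (hflag _ _ h3 hd.2.2.1) (not_lt.2 (h1 n))) (h1 n)
      rw [Fintype.sum_bool, two_mul]
      exact Nat.add_le_add (h2 _) (h2 _)
    refine h1.trans ?_
    rw [← Finset.sum_image (f := w) (g := fun x : α × Bool => (step L R)^[ij x.1 x.2] x.1)]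
    · refine Finset.sum_le_sum_of_subset ?_
      intro y hy
      obtain ⟨⟨e, b⟩, hx, rfl⟩ := Finset.mem_image.1 hy
      simp only [Finset.mem_product, Finset.mem_univ, and_true] at hx
      simpa using (hij e hx).2.2 b
    · have key : ∀ (e e' : α) (i j : ℕ), e ∈ C → e' ∈ C →
          (step L R)^[i] e = (step L R)^[j] e' → lab e ≤ lab e' := by
        intro e e' i j he he' h
        have h2 := he'
        simp only [hC, Finset.mem_filter, Finset.mem_univ, true_and] at h2
        obtain ⟨-, p, -, hpe⟩ := h2
        have hmul : (step L R)^[(p + 1) * j] e' = e' := by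
          rw [Function.iterate_mul]
          exact Function.iterate_fixed hpe j
        have h3 : (step L R)^[p * j + i] e = e' := by
          rw [Function.iterate_add_apply, h, ← Function.iterate_add_apply, ← Nat.succ_mul]
          exact hmul
        rw [← h3]
        exact (hij e he).1 _
      rintro ⟨e, b⟩ h1 ⟨e', b'⟩ h2 h
      simp only [Finset.coe_product, Set.mem_prod, Finset.mem_coe, Finset.mem_univ,
        and_true] at h1 h2
      have h3 : e = e' := hlab (le_antisymm (key _ _ _ _ h1 h2 h) (key _ _ _ _ h2 h1 h.symm))
      subst h3
      have h4 := (hij e h1).2.1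
      have h5 : b = b' := by
        by_contra hb
        rcases b with _ | _ <;> rcases b' with _ | _
        · exact hb rfl
        · exact h4 h
        · exact h4 h.symm
        · exact hb rfl
      rw [h5]
  have h2 := two_mul_sum_oriented (r := r) hL hR hlab w hwL
  rw [hsplit] at h2
  -- The surplus of the fixed points cancels the loss in `C`; the loss in `A` is the error term.
  nlinarith [h2, hsumA, hsumC]

end PathRounding

/-! ### Pairing neighbouring identifiers -/

/-- Consecutive elements of a finite set of naturals can be paired up, with at most one left over. -/
theorem exists_consecutive_pairing (A : Finset ℕ) : ∃ τ : ℕ → ℕ, Function.Involutive τ ∧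
    (∀ x ∈ A, τ x ∈ A) ∧ (∀ x, x ∉ A → τ x = x) ∧
    (∀ x ∈ A, ∀ y ∈ A, τ x = x → τ y = y → x = y) ∧
    (∀ x ∈ A, ∀ y ∈ A, x ≤ y → y ≤ τ x → y = x ∨ y = τ x) := by
  induction hn : A.card using Nat.strong_induction_on generalizing A with
  | _ n ih =>
    rcases le_or_gt A.card 1 with h1 | h1
    · exact ⟨id, fun _ => rfl, fun _ h => h, fun _ _ => rfl,
        fun x hx y hy _ _ => Finset.card_le_one.1 h1 x hx y hy, fun x hx y hy _ _ =>
          Or.inl (Finset.card_le_one.1 h1 y hy x hx)⟩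
    · have hA : A.Nonempty := Finset.card_pos.1 (by omega)
      set a := A.min' hA with ha
      have haA : a ∈ A := A.min'_mem hA
      have hB : (A.erase a).Nonempty := Finset.card_pos.1 (by
        rw [Finset.card_erase_of_mem haA]; omega)
      set b := (A.erase a).min' hB with hb
      have hbA : b ∈ A.erase a := (A.erase a).min'_mem hB
      have hmin : ∀ x ∈ A, a ≤ x := fun x hx => A.min'_le x hx
      have hmin' : ∀ x ∈ A, x ≠ a → b ≤ x := fun x hx hxa =>
        (A.erase a).min'_le x (Finset.mem_erase.2 ⟨hxa, hx⟩)
      clear_value a b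
      have hba : b ≠ a := (Finset.mem_erase.1 hbA).1
      have hbA' : b ∈ A := (Finset.mem_erase.1 hbA).2
      obtain ⟨τ, h2, h3, h4, h5, h6⟩ := ih ((A.erase a).erase b).card (by
        rw [Finset.card_erase_of_mem hbA, Finset.card_erase_of_mem haA]; omega) _ rfl
      have hτa : τ a = a := h4 a (by simp)
      have hτb : τ b = b := h4 b (by simp)
      have hmem : ∀ x, x ∈ (A.erase a).erase b ↔ x ∈ A ∧ x ≠ a ∧ x ≠ b := by
        intro x; simp only [Finset.mem_erase]; tauto
      have hneA : ∀ x, x ≠ a → τ x ≠ a := fun x hx h => hx (by rw [← h2 x, h, hτa])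
      have hneB : ∀ x, x ≠ b → τ x ≠ b := fun x hx h => hx (by rw [← h2 x, h, hτb])
      simp only [hmem] at h3 h4 h5 h6
      refine ⟨fun x => if x = a then b else if x = b then a else τ x, ?_, ?_, ?_, ?_, ?_⟩
      · intro x
        have := h2 x
        have := hneA x
        have := hneB x
        dsimp only
        grind
      · intro x hx
        have := h3 x
        dsimp only
        grind
      · intro x hx
        have := h4 x
        dsimp only
        grind
      · intro x hx y hy
        have := h5 x
        have := h5 y
        dsimp only
        grind
      · intro x hx y hy hxy hyx
        have := h6 x
        have := hmin y hy
        have := hmin x hx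
        have := hmin' y hy
        have := hmin' x hx
        dsimp only at hyx ⊢
        grind

/-- A fixed choice of a pairing of consecutive elements. -/
noncomputable def pairing (A : Finset ℕ) : ℕ → ℕ := (exists_consecutive_pairing A).choose

theorem pairing_involutive (A : Finset ℕ) : Function.Involutive (pairing A) :=
  (exists_consecutive_pairing A).choose_spec.1

theorem pairing_mem {A : Finset ℕ} {x : ℕ} (hx : x ∈ A) : pairing A x ∈ A :=
  (exists_consecutive_pairing A).choose_spec.2.1 x hx

theorem eq_of_pairing_eq {A : Finset ℕ} {x y : ℕ} (hx : x ∈ A) (hy : y ∈ A)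
    (h : pairing A x = x) (h' : pairing A y = y) : x = y :=
  (exists_consecutive_pairing A).choose_spec.2.2.2.1 x hx y hy h h'

theorem pairing_consecutive {A : Finset ℕ} {x y : ℕ} (hx : x ∈ A) (hy : y ∈ A) (h : x ≤ y)
    (h' : y ≤ pairing A x) : y = x ∨ y = pairing A x :=
  (exists_consecutive_pairing A).choose_spec.2.2.2.2 x hx y hy h h'

/-- A set that contains at most one element of each pair of an involution, and at most one fixed
point, has at most half of the elements, rounded up. -/
theorem two_mul_card_le_of_involution {β : Type*} [DecidableEq β] (F S : Finset β) (hSF : S ⊆ F)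
    (L : β → β) (hL : Function.Involutive L) (hLF : ∀ e ∈ F, L e ∈ F)
    (hS : ∀ e ∈ S, L e ≠ e → L e ∉ S)
    (hfix : ∀ e ∈ F, ∀ e' ∈ F, L e = e → L e' = e' → e = e') : 2 * S.card ≤ F.card + 1 := by
  have h1 : (S ∪ S.image L).card + (S ∩ S.image L).card = S.card + S.card := by
    rw [Finset.card_union_add_card_inter, Finset.card_image_of_injective _ hL.injective]
  have h2 : (S ∪ S.image L).card ≤ F.card := by
    refine Finset.card_le_card (Finset.union_subset hSF ?_)
    intro y hy
    obtain ⟨x, hx, rfl⟩ := Finset.mem_image.1 hy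
    exact hLF x (hSF hx)
  have h4 : ∀ x ∈ S ∩ S.image L, L x = x := by
    intro x hx
    obtain ⟨hx1, hx2⟩ := Finset.mem_inter.1 hx
    obtain ⟨z, hz, rfl⟩ := Finset.mem_image.1 hx2
    by_contra h
    exact hS _ hx1 h (by rwa [hL])
  have h3 : (S ∩ S.image L).card ≤ 1 := by
    refine Finset.card_le_one.2 fun x hx y hy => ?_
    exact hfix x (hSF (Finset.mem_inter.1 hx).1) y (hSF (Finset.mem_inter.1 hy).1) (h4 x hx)
      (h4 y hy)
  omega

/-! ### One step of colour reduction -/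

/-- Small subsets of `range m` can be coded by small numbers. -/
theorem exists_code (m d : ℕ) : ∃ f : Finset ℕ → ℕ,
    (∀ S, S ⊆ Finset.range m → S.card ≤ d → f S < (m + 1) ^ d) ∧
    ∀ S T, S ⊆ Finset.range m → S.card ≤ d → T ⊆ Finset.range m → T.card ≤ d → f S = f T →
      S = T := by
  have hex : ∀ S : Finset ℕ, ∃ n : ℕ, S ⊆ Finset.range m → S.card ≤ d →
      ∃ g : Fin d → Fin (m + 1), n = (Fintype.equivFin (Fin d → Fin (m + 1)) g : ℕ) ∧
        S = ((Finset.univ.image fun i => (g i : ℕ)).filter (· < m)) := by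
    intro S
    by_cases h : S ⊆ Finset.range m ∧ S.card ≤ d
    swap
    · exact ⟨0, fun h1 h2 => absurd ⟨h1, h2⟩ h⟩
    obtain ⟨h1, h2⟩ := h
    -- The elements of `S` are listed in order; the value `m` pads the unused coordinates and is
    -- filtered out on decoding.
    let g : Fin d → Fin (m + 1) := fun i =>
      if hi : (i : ℕ) < S.card then
        ⟨S.orderEmbOfFin rfl ⟨i, hi⟩, by
          have := h1 (S.orderEmbOfFin_mem rfl ⟨i, hi⟩)
          simp at this; omega⟩
      else Fin.last m
    refine ⟨_, fun _ _ => ⟨g, rfl, ?_⟩⟩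
    ext x
    simp only [Finset.mem_filter, Finset.mem_image, Finset.mem_univ, true_and]
    constructor
    · intro hx
      have hx' : x ∈ Set.range (S.orderEmbOfFin rfl) := by
        rw [Finset.range_orderEmbOfFin]; exact hx
      obtain ⟨i, rfl⟩ := hx'
      refine ⟨⟨⟨i, i.2.trans_le h2⟩, ?_⟩, by simpa using h1 hx⟩
      simp [g]
    · rintro ⟨⟨i, rfl⟩, hx⟩
      by_cases hi : (i : ℕ) < S.card
      · simp only [g, hi, dif_pos]
        exact S.orderEmbOfFin_mem rfl _
      · simp [g, hi] at hx
  choose f hf using hex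
  refine ⟨f, fun S h1 h2 => ?_, fun S T h1 h2 h3 h4 h => ?_⟩
  · obtain ⟨g, hg, -⟩ := hf S h1 h2
    rw [hg]
    refine (Fin.is_lt _).trans_eq ?_
    simp
  · obtain ⟨g, hg, hS⟩ := hf S h1 h2
    obtain ⟨g', hg', hT⟩ := hf T h3 h4
    rw [hg, hg'] at h
    have := (Fintype.equivFin _).injective (Fin.ext h)
    rw [hS, hT, this]

/-- A fixed code for the small subsets of `range m`. -/
noncomputable def finsetCode (m d : ℕ) : Finset ℕ → ℕ := (exists_code m d).choose

/-- The first binary digit in which two numbers differ. -/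
noncomputable def diffBit (x y : ℕ) : ℕ := sInf {i | x.testBit i ≠ y.testBit i}

theorem testBit_diffBit {x y : ℕ} (h : x ≠ y) :
    x.testBit (diffBit x y) ≠ y.testBit (diffBit x y) := by
  have : {i | x.testBit i ≠ y.testBit i}.Nonempty := by
    by_contra hne
    rw [Set.not_nonempty_iff_eq_empty, Set.eq_empty_iff_forall_notMem] at hne
    exact h (Nat.eq_of_testBit_eq fun i => by simpa using hne i)
  exact Nat.sInf_mem this

theorem diffBit_lt {x y k : ℕ} (h : x ≠ y) (hx : x < 2 ^ k) (hy : y < 2 ^ k) :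
    diffBit x y < k := by
  by_contra hk
  have hpow : 2 ^ k ≤ 2 ^ diffBit x y := Nat.pow_le_pow_right (by norm_num) (by omega)
  exact testBit_diffBit h (by
    rw [Nat.testBit_lt_two_pow (hx.trans_le hpow), Nat.testBit_lt_two_pow (hy.trans_le hpow)])

/-- The positions and values of binary digits that distinguish `x` from the elements of `S`. -/
noncomputable def distinguishing (x : ℕ) (S : Finset ℕ) : Finset ℕ :=
  S.image fun y => 2 * diffBit x y + (x.testBit (diffBit x y)).toNat

/-- The number of binary digits of the new colours when colours with `k` digits are reduced on a
graph of maximum degree `d`. -/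
def nextBits (d k : ℕ) : ℕ := d * Nat.clog 2 (2 * k + 1)

/-- The new colour of a node with colour `x` whose neighbours have the colours in `S`. -/
noncomputable def recolour (d k x : ℕ) (S : Finset ℕ) : ℕ :=
  finsetCode (2 * k) d (distinguishing x S)

section recolour

variable {d k x : ℕ} {S : Finset ℕ}

theorem distinguishing_subset (hx : x < 2 ^ k) (hS : ∀ y ∈ S, y < 2 ^ k) (hxS : x ∉ S) :
    distinguishing x S ⊆ Finset.range (2 * k) := by
  intro z hz
  obtain ⟨y, hy, rfl⟩ := Finset.mem_image.1 hz
  have h1 := diffBit_lt (fun h : x = y => hxS (h ▸ hy)) hx (hS y hy)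
  have h2 := Bool.toNat_le (x.testBit (diffBit x y))
  simp only [Finset.mem_range]
  omega

theorem recolour_lt (hx : x < 2 ^ k) (hS : ∀ y ∈ S, y < 2 ^ k) (hxS : x ∉ S) (hd : S.card ≤ d) :
    recolour d k x S < 2 ^ nextBits d k := by
  refine ((exists_code (2 * k) d).choose_spec.1 _ (distinguishing_subset hx hS hxS)
    (Finset.card_image_le.trans hd)).trans_le ?_
  rw [nextBits, mul_comm d, pow_mul]
  exact Nat.pow_le_pow_left (Nat.le_pow_clog (by norm_num) _) _

/-- If the new colours agreed, so would the coded sets. Then the set of `y` would contain the first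
position where `x` and `y` differ together with the digit of `x` there, although it records only
digits of `y`. -/
theorem recolour_ne {y : ℕ} {T : Finset ℕ} (hx : x < 2 ^ k) (hS : ∀ y ∈ S, y < 2 ^ k)
    (hxS : x ∉ S) (hd : S.card ≤ d) (hy : y < 2 ^ k) (hT : ∀ x ∈ T, x < 2 ^ k)
    (hyT : y ∉ T) (hd' : T.card ≤ d) (hxy : y ∈ S) :
    recolour d k x S ≠ recolour d k y T := by
  intro h
  have h1 := (exists_code (2 * k) d).choose_spec.2 _ _ (distinguishing_subset hx hS hxS)
    (Finset.card_image_le.trans hd) (distinguishing_subset hy hT hyT)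
    (Finset.card_image_le.trans hd') h
  have h2 : 2 * diffBit x y + (x.testBit (diffBit x y)).toNat ∈ distinguishing x S :=
    Finset.mem_image_of_mem _ hxy
  rw [h1] at h2
  obtain ⟨z, -, hz⟩ := Finset.mem_image.1 h2
  have h3 := Bool.toNat_le (x.testBit (diffBit x y))
  have h4 := Bool.toNat_le (y.testBit (diffBit y z))
  have h5 : diffBit y z = diffBit x y := by omega
  rw [h5] at hz
  have h6 := testBit_diffBit (fun h : x = y => hxS (h ▸ hxy))
  revert h6 hz
  cases x.testBit (diffBit x y) <;> cases y.testBit (diffBit x y) <;> simp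

end recolour

/-! ### Networks and locality as invariance under bisimulation -/

/-- A finite network whose nodes have unique identifiers and colours. -/
structure Net : Type (u + 1) where
  V : Type u
  fintypeV : Fintype V
  G : SimpleGraph V
  ident : V → ℕ
  ident_injective : Function.Injective ident
  col : V → ℕ

attribute [instance] Net.fintypeV

namespace Net

/-- Nodes of two networks are similar at radius `t` if they cannot be distinguished in `t` rounds. -/
def Sim (X Y : Net.{u}) : ℕ → X.V → Y.V → Prop
  | 0, v, v' => X.ident v = Y.ident v' ∧ X.col v = Y.col v'
  | t + 1, v, v' => Sim X Y t v v' ∧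
      (∀ u, X.G.Adj v u → ∃ u', Y.G.Adj v' u' ∧ Sim X Y t u u') ∧
      (∀ u', Y.G.Adj v' u' → ∃ u, X.G.Adj v u ∧ Sim X Y t u u')

variable {X Y : Net.{u}}

theorem Sim.mono {s t : ℕ} (hst : s ≤ t) {v : X.V} {v' : Y.V} (h : Sim X Y t v v') :
    Sim X Y s v v' := by
  induction hst with
  | refl => exact h
  | step _ ih => exact ih h.1

theorem Sim.ident_eq {t : ℕ} {v : X.V} {v' : Y.V} (h : Sim X Y t v v') :
    X.ident v = Y.ident v' := (h.mono (Nat.zero_le t)).1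

theorem Sim.col_eq {t : ℕ} {v : X.V} {v' : Y.V} (h : Sim X Y t v v') :
    X.col v = Y.col v' := (h.mono (Nat.zero_le t)).2

theorem Sim.symm {t : ℕ} {v : X.V} {v' : Y.V} (h : Sim X Y t v v') : Sim Y X t v' v := by
  induction t generalizing v v' with
  | zero => exact ⟨h.1.symm, h.2.symm⟩
  | succ t ih =>
    refine ⟨ih h.1, fun u' hu' => ?_, fun u hu => ?_⟩
    · obtain ⟨u, hu, h1⟩ := h.2.2 u' hu'
      exact ⟨u, hu, ih h1⟩
    · obtain ⟨u', hu', h1⟩ := h.2.1 u hu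
      exact ⟨u', hu', ih h1⟩

theorem Sim.exists_adj {t : ℕ} {v u : X.V} {v' : Y.V} (h : Sim X Y (t + 1) v v')
    (hu : X.G.Adj v u) : ∃ u', Y.G.Adj v' u' ∧ Sim X Y t u u' := h.2.1 u hu

theorem Sim.of_adj {t : ℕ} {v u : X.V} {v' u' : Y.V} (h : Sim X Y (t + 1) v v')
    (hu : X.G.Adj v u) (hi : X.ident u = Y.ident u') : Y.G.Adj v' u' ∧ Sim X Y t u u' := by
  obtain ⟨u'', h1, h2⟩ := h.exists_adj hu
  have : u'' = u' := Y.ident_injective (h2.ident_eq.symm.trans hi)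
  exact this ▸ ⟨h1, h2⟩

/-- `P` and `P'` are computed by the same `t`-round algorithm, where each node knows which
identifiers are related to it. -/
def RelSim (X Y : Net.{u}) (t : ℕ) (P : X.V → X.V → Prop) (P' : Y.V → Y.V → Prop) : Prop :=
  ∀ v v' u u', Sim X Y t v v' → X.ident u = Y.ident u' → (P v u ↔ P' v' u')

/-- `f` and `f'` are computed by the same `t`-round algorithm. -/
def FunSim {β : Type*} (X Y : Net.{u}) (t : ℕ) (f : X.V → β) (f' : Y.V → β) : Prop :=
  ∀ v v', Sim X Y t v v' → f v = f' v'

section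

variable {t : ℕ} {P Q : X.V → X.V → Prop} {P' Q' : Y.V → Y.V → Prop}

theorem RelSim.mono {s : ℕ} (hts : t ≤ s) (h : RelSim X Y t P P') : RelSim X Y s P P' :=
  fun v v' u u' h1 h2 => h v v' u u' (h1.mono hts) h2

theorem FunSim.mono {β : Type*} {f : X.V → β} {f' : Y.V → β} {s : ℕ} (hts : t ≤ s)
    (h : FunSim X Y t f f') : FunSim X Y s f f' :=
  fun v v' h1 => h v v' (h1.mono hts)

theorem relSim_adj : RelSim X Y 1 X.G.Adj Y.G.Adj := fun _ _ _ _ h1 h2 =>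
  ⟨fun h => (h1.of_adj h h2).1, fun h => (h1.symm.of_adj h h2.symm).1⟩

theorem RelSim.or (hP : RelSim X Y t P P') (hQ : RelSim X Y t Q Q') :
    RelSim X Y t (fun v u => P v u ∨ Q v u) (fun v u => P' v u ∨ Q' v u) :=
  fun v v' u u' h1 h2 => or_congr (hP v v' u u' h1 h2) (hQ v v' u u' h1 h2)

theorem RelSim.and_left {f : X.V → Prop} {f' : Y.V → Prop} (hP : RelSim X Y t P P')
    (hf : FunSim X Y t f f') :
    RelSim X Y t (fun v u => P v u ∧ f v) (fun v u => P' v u ∧ f' v) :=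
  fun v v' u u' h1 h2 => and_congr (hP v v' u u' h1 h2) (iff_of_eq (hf v v' h1))

/-- Conditions on the second node of an adjacent pair can be checked with one more round. -/
theorem RelSim.and_adj {s : ℕ} (hst : s + 1 ≤ t) (hP : RelSim X Y t P P')
    (hPG : ∀ v u, P v u → X.G.Adj v u) (hPG' : ∀ v u, P' v u → Y.G.Adj v u)
    (hQ : ∀ v v' u u', Sim X Y s v v' → Sim X Y s u u' → (Q v u ↔ Q' v' u')) :
    RelSim X Y t (fun v u => P v u ∧ Q v u) (fun v u => P' v u ∧ Q' v u) := by
  intro v v' u u' h1 h2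
  constructor
  · rintro ⟨h3, h4⟩
    have h5 := ((h1.mono hst).of_adj (hPG _ _ h3) h2).2
    exact ⟨(hP v v' u u' h1 h2).1 h3, (hQ v v' u u' (h1.mono (by omega)) h5).1 h4⟩
  · rintro ⟨h3, h4⟩
    have h5 := ((h1.symm.mono hst).of_adj (hPG' _ _ h3) h2.symm).2.symm
    exact ⟨(hP v v' u u' h1 h2).2 h3, (hQ v v' u u' (h1.mono (by omega)) h5).2 h4⟩

/-- The other node is a neighbour and can report the relation, at the price of one round. -/
theorem RelSim.flip (hP : RelSim X Y t P P') (hPG : ∀ v u, P v u → X.G.Adj v u)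
    (hPG' : ∀ v u, P' v u → Y.G.Adj v u) :
    RelSim X Y (t + 1) (fun u v => P v u) (fun u v => P' v u) := fun u u' v v' h1 h2 =>
  ⟨fun h => (hP v v' u u' (h1.of_adj (hPG _ _ h).symm h2).2 h1.ident_eq).1 h, fun h =>
    (hP v v' u u' (h1.symm.of_adj (hPG' _ _ h).symm h2.symm).2.symm h1.ident_eq).2 h⟩

open Classical in
/-- The identifiers of the nodes related to `v`. -/
noncomputable def outIds (X : Net.{u}) (P : X.V → X.V → Prop) (v : X.V) : Finset ℕ :=
  ({u | P v u} : Finset X.V).image X.ident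

theorem mem_outIds {v : X.V} {i : ℕ} : i ∈ X.outIds P v ↔ ∃ u, P v u ∧ X.ident u = i := by
  simp [outIds]

theorem ident_mem_outIds {v u : X.V} : X.ident u ∈ X.outIds P v ↔ P v u := by
  rw [mem_outIds]
  exact ⟨fun ⟨w, h1, h2⟩ => X.ident_injective h2 ▸ h1, fun h => ⟨u, h, rfl⟩⟩

open Classical in
theorem card_outIds (v : X.V) : (X.outIds P v).card = ({u | P v u} : Finset X.V).card :=
  Finset.card_image_of_injective _ X.ident_injective

theorem RelSim.exists_iff (hP : RelSim X Y (t + 1) P P') (hPG : ∀ v u, P v u → X.G.Adj v u)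
    (hPG' : ∀ v u, P' v u → Y.G.Adj v u) {v : X.V} {v' : Y.V} (h : Sim X Y (t + 1) v v')
    {p : ℕ → Prop} : (∃ u, P v u ∧ p (X.ident u)) ↔ ∃ u, P' v' u ∧ p (Y.ident u) := by
  constructor
  · rintro ⟨u, h1, h2⟩
    obtain ⟨u', -, h3⟩ := h.exists_adj (hPG _ _ h1)
    exact ⟨u', (hP v v' u u' h h3.ident_eq).1 h1, h3.ident_eq ▸ h2⟩
  · rintro ⟨u, h1, h2⟩
    obtain ⟨u', -, h3⟩ := h.symm.exists_adj (hPG' _ _ h1)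
    exact ⟨u', (hP v v' u' u h h3.ident_eq.symm).2 h1, h3.ident_eq ▸ h2⟩

theorem RelSim.funSim_exists (hP : RelSim X Y (t + 1) P P') (hPG : ∀ v u, P v u → X.G.Adj v u)
    (hPG' : ∀ v u, P' v u → Y.G.Adj v u) :
    FunSim X Y (t + 1) (fun v => ∃ u, P v u) (fun v => ∃ u, P' v u) := fun v v' h => by
  simpa using hP.exists_iff hPG hPG' h (p := fun _ => True)

theorem RelSim.funSim_outIds (hP : RelSim X Y (t + 1) P P') (hPG : ∀ v u, P v u → X.G.Adj v u)
    (hPG' : ∀ v u, P' v u → Y.G.Adj v u) :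
    FunSim X Y (t + 1) (X.outIds P) (Y.outIds P') := fun v v' h => by
  ext i
  rw [mem_outIds, mem_outIds]
  exact hP.exists_iff hPG hPG' h (p := fun j => j = i)

end

/-- The degree of a node. -/
noncomputable def deg (X : Net.{u}) (v : X.V) : ℕ := (X.outIds X.G.Adj v).card

theorem funSim_deg : FunSim X Y 1 X.deg Y.deg := fun v v' h => by
  rw [deg, deg, RelSim.funSim_outIds relSim_adj (fun _ _ h => h) (fun _ _ h => h) v v' h]

open Classical in
theorem deg_eq (v : X.V) : X.deg v = ({u | X.G.Adj v u} : Finset X.V).card := card_outIds v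

theorem deg_pos {v u : X.V} (h : X.G.Adj v u) : 0 < X.deg v :=
  Finset.card_pos.2 ⟨X.ident u, ident_mem_outIds.2 h⟩

/-! ### Pairing arcs at their endpoints -/

open Classical in
/-- The node with identifier `i`, if there is one, and `u` otherwise. -/
noncomputable def withIdent (X : Net.{u}) (i : ℕ) (u : X.V) : X.V :=
  if h : ∃ w, X.ident w = i then h.choose else u

theorem ident_withIdent {i : ℕ} {u : X.V} (h : ∃ w, X.ident w = i) :
    X.ident (X.withIdent i u) = i := by
  rw [withIdent, dif_pos h]
  exact h.choose_spec

open Classical in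
/-- The arc that is paired with `e` at its tail. -/
noncomputable def tailMate (X : Net.{u}) (F : X.V → X.V → Prop) (e : X.V × X.V) : X.V × X.V :=
  if F e.1 e.2 then (e.1, X.withIdent (pairing (X.outIds F e.1) (X.ident e.2)) e.2) else e

/-- The arc that is paired with `e` at its head. -/
noncomputable def headMate (X : Net.{u}) (F : X.V → X.V → Prop) (e : X.V × X.V) : X.V × X.V :=
  (X.tailMate (fun u v => F v u) e.swap).swap

section

variable {F : X.V → X.V → Prop} {e : X.V × X.V}

theorem tailMate_of_not (h : ¬ F e.1 e.2) : X.tailMate F e = e := if_neg h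

theorem tailMate_fst : (X.tailMate F e).1 = e.1 := by
  rw [tailMate]
  split_ifs <;> rfl

theorem ident_tailMate_snd (h : F e.1 e.2) :
    X.ident (X.tailMate F e).2 = pairing (X.outIds F e.1) (X.ident e.2) := by
  rw [tailMate, if_pos h]
  refine ident_withIdent ?_
  obtain ⟨w, -, hw⟩ := mem_outIds.1 (pairing_mem (ident_mem_outIds.2 h))
  exact ⟨w, hw⟩

theorem tailMate_mem (h : F e.1 e.2) : F (X.tailMate F e).1 (X.tailMate F e).2 := by
  rw [tailMate_fst, ← ident_mem_outIds (P := F), ident_tailMate_snd h]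
  exact pairing_mem (ident_mem_outIds.2 h)

theorem tailMate_eq_iff : X.tailMate F e = e ↔ X.ident (X.tailMate F e).2 = X.ident e.2 :=
  ⟨fun h => by rw [h], fun h => Prod.ext tailMate_fst (X.ident_injective h)⟩

variable (F) in
theorem tailMate_involutive : Function.Involutive (X.tailMate F) := by
  intro e
  by_cases h : F e.1 e.2
  · refine Prod.ext (by rw [tailMate_fst, tailMate_fst]) (X.ident_injective ?_)
    rw [ident_tailMate_snd (tailMate_mem h), tailMate_fst, ident_tailMate_snd h]
    exact pairing_involutive _ _
  · rw [tailMate_of_not h, tailMate_of_not h]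

theorem eq_of_tailMate_eq {v u w : X.V} (h : F v u) (h' : F v w)
    (hu : X.tailMate F (v, u) = (v, u)) (hw : X.tailMate F (v, w) = (v, w)) : u = w := by
  refine X.ident_injective (eq_of_pairing_eq (A := X.outIds F v) (ident_mem_outIds.2 h)
    (ident_mem_outIds.2 h') ?_ ?_)
  · rw [← ident_tailMate_snd (e := (v, u)) h, hu]
  · rw [← ident_tailMate_snd (e := (v, w)) h', hw]

theorem headMate_of_not (h : ¬ F e.1 e.2) : X.headMate F e = e := by
  rw [headMate, tailMate_of_not (by simpa using h), Prod.swap_swap]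

theorem headMate_snd : (X.headMate F e).2 = e.2 := tailMate_fst (e := e.swap)

theorem headMate_mem (h : F e.1 e.2) : F (X.headMate F e).1 (X.headMate F e).2 :=
  tailMate_mem (F := fun u v => F v u) (e := e.swap) h

theorem headMate_eq_iff : X.headMate F e = e ↔ X.ident (X.headMate F e).1 = X.ident e.1 :=
  ⟨fun h => by rw [h], fun h => Prod.ext (X.ident_injective h) headMate_snd⟩

variable (F) in
theorem headMate_involutive : Function.Involutive (X.headMate F) := by
  intro e
  simp only [headMate, Prod.swap_swap]
  rw [tailMate_involutive, Prod.swap_swap]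

theorem eq_of_headMate_eq {v w u : X.V} (h : F v u) (h' : F w u)
    (hu : X.headMate F (v, u) = (v, u)) (hw : X.headMate F (w, u) = (w, u)) : v = w := by
  refine eq_of_tailMate_eq (F := fun u v => F v u) (v := u) h h' ?_ ?_
  · exact Prod.swap_injective hu
  · exact Prod.swap_injective hw

end

/-! ### One rounding step -/

open Classical in
/-- The labels used to direct the alternating walks. -/
noncomputable def arcLabel (X : Net.{u}) (F : X.V → X.V → Prop) (e : X.V × X.V) :
    ℕ ×ₗ (ℕ ×ₗ ℕ) :=
  toLex (if X.headMate F e = e then 0 else X.deg e.1, toLex (X.ident e.1, X.ident e.2))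

/-- The arcs whose value is doubled when the arcs in `F` are rounded. -/
def rounded (X : Net.{u}) (F : X.V → X.V → Prop) (r : ℕ) (v u : X.V) : Prop :=
  F v u ∧ PathRounding.Kept (X.tailMate F) (X.headMate F) (X.arcLabel F) r (v, u)

section

variable {F : X.V → X.V → Prop} {r : ℕ}

theorem arcLabel_injective : Function.Injective (X.arcLabel F) := by
  intro e e' h
  have h1 := toLex.injective h
  simp only [Prod.mk.injEq, EmbeddingLike.apply_eq_iff_eq] at h1
  exact Prod.ext (X.ident_injective h1.2.1) (X.ident_injective h1.2.2)

theorem mem_of_headMate_ne {e : X.V × X.V} (h : X.headMate F e ≠ e) : F e.1 e.2 := by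
  by_contra h'
  exact h (headMate_of_not h')

-- The walks live on all ordered pairs, with weight 0 and trivial pairings off `F`. The components
-- of `arcLabel` supply the hypotheses of `PathRounding.sum_kept`: the leading 0 puts arcs unpaired
-- at their heads first, the degree makes weight monotone in the label, and the identifiers make
-- paired arcs at a tail consecutive.
open Classical in
theorem sum_rounded (hF : ∀ v u, F v u → X.G.Adj v u) :
    (r + 1) * ∑ e : X.V × X.V with F e.1 e.2, X.deg e.1
      ≤ 2 * (r + 1) * (∑ e : X.V × X.V with X.rounded F r e.1 e.2, X.deg e.1)
        + 2 * ∑ e : X.V × X.V with F e.1 e.2, X.deg e.1 := by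
  have hpos : ∀ e, X.headMate F e ≠ e → 0 < X.deg e.1 := fun e he =>
    deg_pos (hF _ _ (mem_of_headMate_ne he))
  have key := PathRounding.sum_kept (r := r) (tailMate_involutive F) (headMate_involutive F)
    (arcLabel_injective (F := F)) ?_ ?_ (fun e => if F e.1 e.2 then X.deg e.1 else 0) ?_ ?_
  · rw [Finset.sum_ite, Finset.sum_const_zero, add_zero, ← Finset.sum_filter] at key
    rw [Finset.filter_filter] at key
    have : ∀ e : X.V × X.V, (PathRounding.Kept (X.tailMate F) (X.headMate F) (X.arcLabel F) r e ∧
        F e.1 e.2) ↔ X.rounded F r e.1 e.2 := fun e => and_comm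
    simp only [this] at key
    exact key
  · intro x y hx hy
    simp only [arcLabel, hx, hy, if_true, if_false]
    rw [Prod.Lex.toLex_lt_toLex]
    exact Or.inl (hpos y hy)
  · intro x y hx hx' h1 h2
    have hxF := mem_of_headMate_ne hx
    have hdeg := hpos x hx
    have hy : X.headMate F y ≠ y := by
      intro hy
      simp only [arcLabel, hx, hy, if_true, if_false] at h1
      rcases Prod.Lex.toLex_le_toLex.1 h1 with h3 | h3
      · simp at h3
      · exact hdeg.ne' h3.1
    simp only [arcLabel, hx, hy, hx', if_false, tailMate_fst] at h1 h2
    have h3 : X.deg x.1 = X.deg y.1 :=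
      le_antisymm (PathRounding.fst_le_of_lex h1) (PathRounding.fst_le_of_lex h2)
    rw [h3] at h1 h2
    simp only [Prod.Lex.toLex_le_toLex, lt_irrefl, false_or, true_and] at h1 h2
    have h4 : X.ident x.1 = X.ident y.1 := by
      rcases h1 with h1 | h1 <;> rcases h2 with h2 | h2 <;> omega
    rw [h4] at h1 h2
    simp only [lt_irrefl, false_or, true_and] at h1 h2
    have h5 : x.1 = y.1 := X.ident_injective h4
    have hyF := mem_of_headMate_ne hy
    rw [ident_tailMate_snd hxF] at h2
    rcases pairing_consecutive (ident_mem_outIds.2 hxF) (by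
      rw [h5]; exact ident_mem_outIds.2 hyF) h1 h2 with h6 | h6
    · exact Or.inl (Prod.ext h5.symm (X.ident_injective h6))
    · right
      refine Prod.ext (by rw [tailMate_fst, h5]) (X.ident_injective ?_)
      rw [h6, ident_tailMate_snd hxF]
  · intro e
    by_cases h : F e.1 e.2
    · rw [if_pos (tailMate_mem h), if_pos h, tailMate_fst]
    · simp only [tailMate_of_not h]
  · intro x y hx hy h
    simp only [mem_of_headMate_ne hx, mem_of_headMate_ne hy, if_true]
    simp only [arcLabel, hx, hy, if_false] at h
    exact PathRounding.fst_le_of_lex h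

theorem not_rounded_tailMate {e : X.V × X.V} (h : X.rounded F r e.1 e.2)
    (hne : X.tailMate F e ≠ e) : ¬ X.rounded F r (X.tailMate F e).1 (X.tailMate F e).2 := by
  intro h'
  have h1 := h.2.1
  have h2 := h'.2.1
  simp only [Prod.mk.eta] at h1 h2
  rcases h1 with h1 | h1
  · exact hne h1
  · rcases h2 with h2 | h2
    · rw [tailMate_involutive F e] at h2
      exact hne h2.symm
    · rw [tailMate_involutive F e] at h2
      exact absurd h1 h2.not_gt

theorem not_rounded_headMate {e : X.V × X.V} (h : X.rounded F r e.1 e.2)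
    (hne : X.headMate F e ≠ e) : ¬ X.rounded F r (X.headMate F e).1 (X.headMate F e).2 := by
  intro h'
  have h1 := h.2
  have h2 := h'.2
  simp only [Prod.mk.eta] at h1 h2
  obtain ⟨h1, h3⟩ := h1
  obtain ⟨h2, h4⟩ := h2
  rw [headMate_involutive F e] at h4
  rcases h3 with h3 | h3 | h3
  · exact hne h3
  · exact h3 h2
  · rcases h4 with h4 | h4 | h4
    · exact hne h4.symm
    · exact h4 h1
    · exact absurd h3 h4.not_gt

open Classical in
theorem card_rounded_out (v : X.V) :
    2 * ({u | X.rounded F r v u} : Finset X.V).card ≤ ({u | F v u} : Finset X.V).card + 1 := by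
  have hL : Function.Involutive fun u => (X.tailMate F (v, u)).2 := by
    intro u
    have h1 : (v, (X.tailMate F (v, u)).2) = X.tailMate F (v, u) :=
      Prod.ext (tailMate_fst (e := (v, u))).symm rfl
    simp only [h1]
    rw [tailMate_involutive F]
  have heta : ∀ u, X.tailMate F (v, u) = (v, (X.tailMate F (v, u)).2) := fun u =>
    Prod.ext (tailMate_fst (e := (v, u))) rfl
  refine two_mul_card_le_of_involution _ _ ?_ _ hL ?_ ?_ ?_
  · intro u hu
    simp only [Finset.mem_filter, Finset.mem_univ, true_and] at hu ⊢
    exact hu.1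
  · intro u hu
    simp only [Finset.mem_filter, Finset.mem_univ, true_and] at hu ⊢
    have := tailMate_mem (X := X) (F := F) (e := (v, u)) hu
    rwa [tailMate_fst] at this
  · intro u hu hne
    simp only [Finset.mem_filter, Finset.mem_univ, true_and] at hu ⊢
    have := not_rounded_tailMate (e := (v, u)) hu (fun h => hne (by rw [h]))
    rwa [tailMate_fst] at this
  · intro u hu w hw hu' hw'
    simp only [Finset.mem_filter, Finset.mem_univ, true_and] at hu hw
    exact eq_of_tailMate_eq hu hw (by rw [heta, hu']) (by rw [heta, hw'])

open Classical in
theorem card_rounded_in (u : X.V) :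
    2 * ({v | X.rounded F r v u} : Finset X.V).card ≤ ({v | F v u} : Finset X.V).card + 1 := by
  have heta : ∀ v, X.headMate F (v, u) = ((X.headMate F (v, u)).1, u) := fun v =>
    Prod.ext rfl (headMate_snd (e := (v, u)))
  have hL : Function.Involutive fun v => (X.headMate F (v, u)).1 := by
    intro v
    simp only [← heta]
    rw [headMate_involutive F]
  refine two_mul_card_le_of_involution _ _ ?_ _ hL ?_ ?_ ?_
  · intro v hv
    simp only [Finset.mem_filter, Finset.mem_univ, true_and] at hv ⊢
    exact hv.1
  · intro v hv
    simp only [Finset.mem_filter, Finset.mem_univ, true_and] at hv ⊢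
    have := headMate_mem (X := X) (F := F) (e := (v, u)) hv
    rwa [headMate_snd] at this
  · intro v hv hne
    simp only [Finset.mem_filter, Finset.mem_univ, true_and] at hv ⊢
    have := not_rounded_headMate (e := (v, u)) hv (fun h => hne (by rw [h]))
    rwa [headMate_snd] at this
  · intro v hv w hw hv' hw'
    simp only [Finset.mem_filter, Finset.mem_univ, true_and] at hv hw
    exact eq_of_headMate_eq hv hw (by rw [heta, hv']) (by rw [heta, hw'])

end

/-- Arcs of two networks whose tails cannot be distinguished in `t` rounds. -/
def ArcSim (X Y : Net.{u}) (t : ℕ) (e : X.V × X.V) (e' : Y.V × Y.V) : Prop :=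
  Sim X Y t e.1 e'.1 ∧ X.ident e.2 = Y.ident e'.2

section

variable {F : X.V → X.V → Prop} {F' : Y.V → Y.V → Prop} {t m r : ℕ} {e : X.V × X.V}
  {e' : Y.V × Y.V}

theorem ArcSim.mono {s : ℕ} (hst : s ≤ t) (h : ArcSim X Y t e e') : ArcSim X Y s e e' :=
  ⟨h.1.mono hst, h.2⟩

theorem ArcSim.tailMate (hF : RelSim X Y (t + 1) F F') (hFG : ∀ v u, F v u → X.G.Adj v u)
    (hFG' : ∀ v u, F' v u → Y.G.Adj v u) (hm : t + 1 ≤ m) (h : ArcSim X Y m e e') :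
    ArcSim X Y m (X.tailMate F e) (Y.tailMate F' e') := by
  have hiff := hF _ _ _ _ (h.1.mono hm) h.2
  by_cases h1 : F e.1 e.2
  · have h2 := hiff.1 h1
    refine ⟨by rw [tailMate_fst, tailMate_fst]; exact h.1, ?_⟩
    rw [ident_tailMate_snd h1, ident_tailMate_snd h2, h.2,
      hF.funSim_outIds hFG hFG' _ _ (h.1.mono hm)]
  · rw [tailMate_of_not h1, tailMate_of_not (mt hiff.2 h1)]
    exact h

/-- The radius drops by two because the new tail is reached from the old one through the common
head; `tailMate` keeps the tail and costs nothing. -/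
theorem ArcSim.headMate (hF : RelSim X Y (t + 1) F F') (hFG : ∀ v u, F v u → X.G.Adj v u)
    (hFG' : ∀ v u, F' v u → Y.G.Adj v u) (hm : t + 1 ≤ m) (h : ArcSim X Y (m + 2) e e') :
    ArcSim X Y m (X.headMate F e) (Y.headMate F' e') := by
  have hiff := hF _ _ _ _ (h.1.mono (by omega)) h.2
  by_cases h1 : F e.1 e.2
  · have h2 := hiff.1 h1
    have h3 : ArcSim X Y (m + 1) e.swap e'.swap :=
      ⟨(h.1.of_adj (hFG _ _ h1) h.2).2, h.1.ident_eq⟩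
    have h4 := h3.tailMate (hF.flip hFG hFG') (fun _ _ h => (hFG _ _ h).symm)
      (fun _ _ h => (hFG' _ _ h).symm) (by omega)
    have h5 := headMate_mem h1
    refine ⟨?_, ?_⟩
    · refine (h4.1.of_adj ?_ h4.2).2
      exact (hFG _ _ h5).symm
    · rw [headMate_snd, headMate_snd]; exact h.2
  · rw [headMate_of_not h1, headMate_of_not (mt hiff.2 h1)]
    exact h.mono (by omega)

theorem ArcSim.walk (hF : RelSim X Y (t + 1) F F') (hFG : ∀ v u, F v u → X.G.Adj v u)
    (hFG' : ∀ v u, F' v u → Y.G.Adj v u) (hm : t + 1 ≤ m) (n : ℕ)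
    (h : ArcSim X Y (m + 2 * n) e e') :
    ArcSim X Y m ((PathRounding.step (X.tailMate F) (X.headMate F))^[n] e)
      ((PathRounding.step (Y.tailMate F') (Y.headMate F'))^[n] e') := by
  induction n generalizing e e' with
  | zero => exact h
  | succ n ih =>
    rw [Function.iterate_succ_apply, Function.iterate_succ_apply]
    refine ih ?_
    exact (ArcSim.headMate hF hFG hFG' (m := m + 2 * n) (by omega) h).tailMate hF hFG hFG'
      (by omega)

theorem ArcSim.arcLabel (hF : RelSim X Y (t + 1) F F') (hFG : ∀ v u, F v u → X.G.Adj v u)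
    (hFG' : ∀ v u, F' v u → Y.G.Adj v u) (h : ArcSim X Y (t + 3) e e') :
    X.arcLabel F e = Y.arcLabel F' e' := by
  have h1 := h.headMate hF hFG hFG' le_rfl
  simp only [Net.arcLabel, headMate_eq_iff]
  rw [h1.1.ident_eq, h.2, h.1.ident_eq, funSim_deg _ _ (h.1.mono (by omega))]

theorem ArcSim.best (hF : RelSim X Y (t + 1) F F') (hFG : ∀ v u, F v u → X.G.Adj v u)
    (hFG' : ∀ v u, F' v u → Y.G.Adj v u) (h : ArcSim X Y (t + 3 + 2 * r) e e') :
    PathRounding.best (X.tailMate F) (X.headMate F) (X.arcLabel F) r e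
      = PathRounding.best (Y.tailMate F') (Y.headMate F') (Y.arcLabel F') r e' := by
  refine Finset.inf'_congr _ rfl fun n hn => ?_
  have hn' : n ≤ r := by simpa [Nat.lt_succ_iff] using hn
  rw [ArcSim.arcLabel hF hFG hFG' ((h.mono (by omega)).walk hF hFG hFG' (by omega) n)]

theorem ArcSim.oriented (hF : RelSim X Y (t + 1) F F') (hFG : ∀ v u, F v u → X.G.Adj v u)
    (hFG' : ∀ v u, F' v u → Y.G.Adj v u) (h : ArcSim X Y (t + 3 + 2 * r) e e') :
    PathRounding.Oriented (X.tailMate F) (X.headMate F) (X.arcLabel F) r e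
      ↔ PathRounding.Oriented (Y.tailMate F') (Y.headMate F') (Y.arcLabel F') r e' := by
  have h1 := h.tailMate hF hFG hFG' (by omega)
  rw [PathRounding.Oriented, PathRounding.Oriented, tailMate_eq_iff, tailMate_eq_iff,
    h.best hF hFG hFG', h1.best hF hFG hFG', h1.2, h.2]

/-- A label needs radius `t + 3`, the `r` steps of a walk `2 * r` more, and comparison with the mate
at the head a further 2. -/
theorem RelSim.rounded (hF : RelSim X Y (t + 1) F F') (hFG : ∀ v u, F v u → X.G.Adj v u)
    (hFG' : ∀ v u, F' v u → Y.G.Adj v u) :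
    RelSim X Y (t + 1 + (2 * r + 4)) (X.rounded F r) (Y.rounded F' r) := by
  intro v v' u u' h1 h2
  have h : ArcSim X Y (t + 3 + 2 * r + 2) (v, u) (v', u') := ⟨h1.mono (by omega), h2⟩
  have h3 := h.headMate hF hFG hFG' (by omega)
  rw [Net.rounded, Net.rounded, hF v v' u u' (h1.mono (by omega)) h2, PathRounding.Kept,
    PathRounding.Kept, headMate_eq_iff, headMate_eq_iff, h3.1.ident_eq, h.1.ident_eq,
    (h.mono (by omega)).oriented hF hFG hFG', h3.oriented hF hFG hFG',
    (h.mono (by omega)).arcLabel hF hFG hFG', (h3.mono (by omega)).arcLabel hF hFG hFG']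

end

end Net

/-! ### Arithmetic of rounding dyadic values -/

-- Truncated subtraction encodes the cap: an element has the value 2^(-min(lev, i + 1)), scaled by
-- 2^(i + 1). The elements that reach the cap are the ones to be rounded.
open Classical in
theorem sum_mul_two_pow_split {β : Type*} [Fintype β] (A : β → Prop) (lev w : β → ℕ) (i : ℕ) :
    ∑ x with A x, w x * 2 ^ (i + 1 - lev x)
      = 2 * (∑ x with A x ∧ lev x < i + 1, w x * 2 ^ (i - lev x))
        + ∑ x with A x ∧ i + 1 ≤ lev x, w x := by
  rw [Finset.mul_sum]
  simp only [Finset.sum_filter]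
  rw [← Finset.sum_add_distrib]
  refine Finset.sum_congr rfl fun x _ => ?_
  by_cases hA : A x
  · rcases lt_or_ge (lev x) (i + 1) with h | h
    · have h1 : i + 1 - lev x = (i - lev x) + 1 := by omega
      simp only [hA, h, h.not_ge, if_true, if_false, true_and, h1, pow_succ]
      ring
    · have h1 : i + 1 - lev x = 0 := by omega
      simp [hA, h, h.not_gt, h1]
  · simp [hA]

open Classical in
theorem sum_mul_two_pow_merge {β : Type*} [Fintype β] (A S : β → Prop) (lev w : β → ℕ) (i : ℕ)
    (hS : ∀ x, S x → i + 1 ≤ lev x) :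
    ∑ x with (A x ∧ lev x < i + 1) ∨ S x, w x * 2 ^ (i - lev x)
      = (∑ x with A x ∧ lev x < i + 1, w x * 2 ^ (i - lev x)) + ∑ x with S x, w x := by
  simp only [Finset.sum_filter]
  rw [← Finset.sum_add_distrib]
  refine Finset.sum_congr rfl fun x _ => ?_
  by_cases hx : S x
  · have h := hS x hx
    have h1 : i - lev x = 0 := by omega
    simp [hx, h.not_gt, h1]
  · simp [hx]

-- Parity absorbs the rounding up in `hcard`: the new sum is an integer and twice it is at most 2^(i
-- + 1) + 1, hence at most 2^(i + 1).
open Classical in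
theorem sum_two_pow_round {β : Type*} [Fintype β] {A S : β → Prop} {lev : β → ℕ} {i : ℕ}
    (hS : ∀ x, S x → i + 1 ≤ lev x)
    (hcard : 2 * ({x | S x} : Finset β).card ≤ ({x | A x ∧ i + 1 ≤ lev x} : Finset β).card + 1)
    (hA : ∑ x with A x, 2 ^ (i + 1 - lev x) ≤ 2 ^ (i + 1)) :
    ∑ x with (A x ∧ lev x < i + 1) ∨ S x, 2 ^ (i - lev x) ≤ 2 ^ i := by
  have h1 := sum_mul_two_pow_split A lev (fun _ => 1) i
  have h2 := sum_mul_two_pow_merge A S lev (fun _ => 1) i hS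
  simp only [one_mul, Finset.sum_const, smul_eq_mul, mul_one] at h1 h2
  rw [h1, pow_succ] at hA
  rw [h2]
  omega

/-! ### Rounding the degree-directed fractional matching to paths and cycles -/

namespace Net

variable {X Y : Net.{u}}

/-- The edges, directed from larger to smaller degree, in both directions if the degrees agree. -/
def arc (X : Net.{u}) (v u : X.V) : Prop := X.G.Adj v u ∧ X.deg u ≤ X.deg v

/-- Initially all arcs with tail `v` have the value `2 ^ (-level v)`. -/
noncomputable def level (X : Net.{u}) (v : X.V) : ℕ := Nat.clog 2 (X.deg v)

/-- The arcs that are left after `j` rounding steps: those with tail `v` have the value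
`2 ^ (-min (level v) (K - j))`. -/
def arcsAt (X : Net.{u}) (r K : ℕ) : ℕ → X.V → X.V → Prop
  | 0 => X.arc
  | j + 1 => fun v u => (arcsAt X r K j v u ∧ X.level v < K - j) ∨
      X.rounded (fun v u => arcsAt X r K j v u ∧ K - j ≤ X.level v) r v u

theorem arcsAt_le (r K j : ℕ) (v u : X.V) (h : X.arcsAt r K j v u) : X.arc v u := by
  induction j with
  | zero => exact h
  | succ j ih =>
    rcases h with h | h
    · exact ih h.1
    · exact ih h.1.1

theorem arcsAt_adj (r K j : ℕ) (v u : X.V) (h : X.arcsAt r K j v u) : X.G.Adj v u :=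
  (arcsAt_le r K j v u h).1

theorem deg_le_two_pow_level (v : X.V) : X.deg v ≤ 2 ^ X.level v :=
  Nat.le_pow_clog (by norm_num) _

theorem two_pow_level_le {v : X.V} (h : 0 < X.deg v) : 2 ^ X.level v ≤ 2 * X.deg v := by
  rcases Nat.lt_or_ge 1 (X.deg v) with h1 | h1
  · have h2 := Nat.pow_pred_clog_lt_self (b := 2) (by norm_num) h1
    have h3 : 0 < Nat.clog 2 (X.deg v) := Nat.clog_pos (by norm_num) h1
    obtain ⟨m, hm⟩ := Nat.exists_eq_succ_of_ne_zero h3.ne'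
    rw [level, hm, pow_succ]
    rw [hm] at h2
    simp only [Nat.pred_eq_sub_one, Nat.succ_eq_add_one, Nat.add_sub_cancel] at h2
    omega
  · have h2 : X.deg v = 1 := by omega
    simp [level, h2]

section

variable {K : ℕ} {r : ℕ}

open Classical in
theorem sum_arcsAt_out_le (hK : ∀ v, X.level v ≤ K) (j : ℕ) (hj : j ≤ K) (v : X.V) :
    ∑ u with X.arcsAt r K j v u, 2 ^ (K - j - X.level v) ≤ 2 ^ (K - j) := by
  induction j with
  | zero =>
    have h1 : ({u | X.arcsAt r K 0 v u} : Finset X.V).card ≤ 2 ^ X.level v := by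
      refine le_trans ?_ (deg_le_two_pow_level v)
      rw [deg_eq]
      exact Finset.card_le_card fun u hu => by
        simp only [Finset.mem_filter, Finset.mem_univ, true_and] at hu ⊢
        exact arcsAt_adj r K 0 v u hu
    rw [Finset.sum_const, smul_eq_mul, Nat.sub_zero]
    refine (Nat.mul_le_mul_right _ h1).trans_eq ?_
    rw [← pow_add, Nat.add_sub_cancel' (hK v)]
  | succ j ih =>
    obtain ⟨i, hi⟩ : ∃ i, K - j = i + 1 := ⟨K - j - 1, by omega⟩
    have hi' : K - (j + 1) = i := by omega
    have ih := ih (by omega)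
    simp only [arcsAt, hi'] at ih ⊢
    simp only [hi] at ih ⊢
    refine sum_two_pow_round (fun u hu => hu.1.2) ?_ ih
    convert card_rounded_out (X := X) (r := r)
      (F := fun v u => X.arcsAt r K j v u ∧ i + 1 ≤ X.level v) v

-- The direction of the arcs matters at the start: a tail has at least the degree of the head, so
-- each of the at most `deg u` incoming arcs has value at most 2^(-level u). The rounding step is
-- symmetric to that for outgoing arcs.
open Classical in
theorem sum_arcsAt_in_le (hK : ∀ v, X.level v ≤ K) (j : ℕ) (hj : j ≤ K) (u : X.V) :
    ∑ v with X.arcsAt r K j v u, 2 ^ (K - j - X.level v) ≤ 2 ^ (K - j) := by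
  induction j with
  | zero =>
    have h1 : ({v | X.arcsAt r K 0 v u} : Finset X.V).card ≤ 2 ^ X.level u := by
      refine le_trans ?_ (deg_le_two_pow_level u)
      rw [deg_eq]
      exact Finset.card_le_card fun v hv => by
        simp only [Finset.mem_filter, Finset.mem_univ, true_and] at hv ⊢
        exact (arcsAt_adj r K 0 v u hv).symm
    have h2 : ∑ v with X.arcsAt r K 0 v u, 2 ^ (K - 0 - X.level v)
        ≤ ∑ v with X.arcsAt r K 0 v u, 2 ^ (K - X.level u) := by
      refine Finset.sum_le_sum fun v hv => Nat.pow_le_pow_right (by norm_num) ?_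
      simp only [Finset.mem_filter, Finset.mem_univ, true_and] at hv
      have : X.level u ≤ X.level v := Nat.clog_mono_right 2 (arcsAt_le r K 0 v u hv).2
      omega
    refine h2.trans ?_
    rw [Finset.sum_const, smul_eq_mul, Nat.sub_zero]
    refine (Nat.mul_le_mul_right _ h1).trans_eq ?_
    rw [← pow_add, Nat.add_sub_cancel' (hK u)]
  | succ j ih =>
    obtain ⟨i, hi⟩ : ∃ i, K - j = i + 1 := ⟨K - j - 1, by omega⟩
    have hi' : K - (j + 1) = i := by omega
    have ih := ih (by omega)
    simp only [arcsAt, hi'] at ih ⊢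
    simp only [hi] at ih ⊢
    refine sum_two_pow_round (fun v hv => hv.1.2) ?_ ih
    convert card_rounded_in (X := X) (r := r)
      (F := fun v u => X.arcsAt r K j v u ∧ i + 1 ≤ X.level v) u

/-- The total value of the arcs after `j` rounding steps, weighted with the degrees of their tails
and multiplied with `2 ^ (K - j)`. -/
noncomputable def arcWeight (X : Net.{u}) (r K j : ℕ) : ℕ :=
  open Classical in
  ∑ e : X.V × X.V with X.arcsAt r K j e.1 e.2, X.deg e.1 * 2 ^ (K - j - X.level e.1)

theorem arcWeight_succ {j : ℕ} (hj : j < K) :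
    (r + 1) * X.arcWeight r K j ≤ 2 * (r + 1) * X.arcWeight r K (j + 1)
      + 2 * X.arcWeight r K j := by
  classical
  obtain ⟨i, hi⟩ : ∃ i, K - j = i + 1 := ⟨K - j - 1, by omega⟩
  have hi' : K - (j + 1) = i := by omega
  have h1 := sum_mul_two_pow_split (fun e : X.V × X.V => X.arcsAt r K j e.1 e.2)
    (fun e => X.level e.1) (fun e => X.deg e.1) i
  have h2 := sum_mul_two_pow_merge (fun e : X.V × X.V => X.arcsAt r K j e.1 e.2)
    (fun e => X.rounded (fun v u => X.arcsAt r K j v u ∧ i + 1 ≤ X.level v) r e.1 e.2)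
    (fun e => X.level e.1) (fun e => X.deg e.1) i (fun e he => he.1.2)
  have h3 : (r + 1) * ∑ e : X.V × X.V with X.arcsAt r K j e.1 e.2 ∧ i + 1 ≤ X.level e.1,
        X.deg e.1
      ≤ 2 * (r + 1) * (∑ e : X.V × X.V with
          X.rounded (fun v u => X.arcsAt r K j v u ∧ i + 1 ≤ X.level v) r e.1 e.2, X.deg e.1)
        + 2 * ∑ e : X.V × X.V with X.arcsAt r K j e.1 e.2 ∧ i + 1 ≤ X.level e.1, X.deg e.1 := by
    convert sum_rounded (X := X) (r := r)
      (F := fun v u => X.arcsAt r K j v u ∧ i + 1 ≤ X.level v)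
      (fun v u h => arcsAt_adj r K j v u h.1)
  have h4 : X.arcWeight r K j
      = ∑ e : X.V × X.V with X.arcsAt r K j e.1 e.2, X.deg e.1 * 2 ^ (i + 1 - X.level e.1) := by
    rw [arcWeight, hi]
  have h5 : X.arcWeight r K (j + 1)
      = ∑ e : X.V × X.V with (X.arcsAt r K j e.1 e.2 ∧ X.level e.1 < i + 1) ∨
        X.rounded (fun v u => X.arcsAt r K j v u ∧ i + 1 ≤ X.level v) r e.1 e.2,
        X.deg e.1 * 2 ^ (i - X.level e.1) := by
    rw [arcWeight, hi']
    simp only [arcsAt, hi]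
  have h6 : ∀ y f s : ℕ, (r + 1) * f ≤ 2 * (r + 1) * s + 2 * f →
      (r + 1) * (2 * y + f) ≤ 2 * (r + 1) * (y + s) + 2 * (2 * y + f) := fun y f s h => by
    linarith
  rw [h4, h5, h1, h2]
  exact h6 _ _ _ h3

/-- With r = 4K a rounding keeps at least the fraction 1 - 2/(4K + 1) ≥ 1 - 1/(2K) of the weight. By
Bernoulli's inequality at least half is left after K of them; the power of two undoes the scaling.
-/
theorem arcWeight_zero_le (hK0 : 1 ≤ K) :
    X.arcWeight (4 * K) K 0 ≤ 2 * 2 ^ K * X.arcWeight (4 * K) K K := by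
  set δ : ℝ := 1 / (2 * K) with hδ
  have hK0' : (1 : ℝ) ≤ K := by exact_mod_cast hK0
  have hδ1 : δ ≤ 1 / 2 := by
    rw [hδ]
    exact one_div_le_one_div_of_le (by norm_num) (by linarith)
  have h1 : ∀ j ≤ K, (1 - δ) ^ j * X.arcWeight (4 * K) K 0
      ≤ 2 ^ j * (X.arcWeight (4 * K) K j : ℝ) := by
    intro j hj
    induction j with
    | zero => simp
    | succ j ih =>
      have h2 := arcWeight_succ (X := X) (r := 4 * K) (K := K) (j := j) (by omega)
      have ih := ih (by omega)
      set a : ℝ := (X.arcWeight (4 * K) K j : ℝ) with ha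
      set b : ℝ := (X.arcWeight (4 * K) K (j + 1) : ℝ) with hb
      have h3 : (4 * (K : ℝ) + 1) * a ≤ 2 * (4 * K + 1) * b + 2 * a := by
        rw [ha, hb]; exact_mod_cast h2
      have ha0 : 0 ≤ a := Nat.cast_nonneg _
      have h4 : (1 - δ) * a ≤ 2 * b := by
        have h5 : (1 - δ) * a * (4 * K + 1) ≤ 2 * b * (4 * K + 1) := by
          have h6 : δ * (4 * K + 1) = 2 + δ := by rw [hδ]; field_simp; ring
          have h7 : 0 ≤ δ := by positivity
          have h8 : (1 - δ) * a * (4 * K + 1) = (4 * K + 1) * a - (2 + δ) * a := by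
            rw [← h6]; ring
          rw [h8]
          nlinarith [mul_nonneg h7 ha0]
        exact le_of_mul_le_mul_right h5 (by positivity)
      calc (1 - δ) ^ (j + 1) * (X.arcWeight (4 * K) K 0 : ℝ)
          = (1 - δ) * ((1 - δ) ^ j * X.arcWeight (4 * K) K 0) := by ring
        _ ≤ (1 - δ) * (2 ^ j * a) := mul_le_mul_of_nonneg_left ih (by linarith)
        _ = 2 ^ j * ((1 - δ) * a) := by ring
        _ ≤ 2 ^ j * (2 * b) := mul_le_mul_of_nonneg_left h4 (by positivity)
        _ = 2 ^ (j + 1) * b := by ring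
  have h2 := h1 K le_rfl
  have h3 : (1 / 2 : ℝ) ≤ (1 - δ) ^ K := by
    have h4 := one_add_mul_le_pow (a := -δ) (by linarith) K
    have h5 : (K : ℝ) * -δ = -(1 / 2) := by rw [hδ]; field_simp
    rw [h5] at h4
    rw [sub_eq_add_neg]
    linarith
  have h6 : (0 : ℝ) ≤ X.arcWeight (4 * K) K 0 := Nat.cast_nonneg _
  have h7 : (X.arcWeight (4 * K) K 0 : ℝ) ≤ 2 * 2 ^ K * X.arcWeight (4 * K) K K := by
    nlinarith [mul_le_mul_of_nonneg_right h3 h6]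
  exact_mod_cast h7

-- Initially each arc has weight deg · 2^(-level) ≥ 1/2.
open Classical in
theorem card_arc_le (hK : ∀ v, X.level v ≤ K) :
    2 ^ K * ({e | X.arc e.1 e.2} : Finset (X.V × X.V)).card ≤ 2 * X.arcWeight r K 0 := by
  rw [arcWeight, Finset.mul_sum, mul_comm, ← smul_eq_mul]
  refine Finset.card_nsmul_le_sum _ _ _ fun e he => ?_
  simp only [Finset.mem_filter, Finset.mem_univ, true_and] at he
  have h1 := two_pow_level_le (deg_pos he.1)
  have h2 : 2 ^ K = 2 ^ X.level e.1 * 2 ^ (K - X.level e.1) := by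
    rw [← pow_add, Nat.add_sub_cancel' (hK _)]
  rw [h2, Nat.sub_zero, ← mul_assoc]
  exact Nat.mul_le_mul_right _ h1

/-- The number of ordered pairs of adjacent nodes. -/
noncomputable def size (X : Net.{u}) : ℕ :=
  open Classical in ({e | X.G.Adj e.1 e.2} : Finset (X.V × X.V)).card

theorem size_le_card_arc : open Classical in
    X.size ≤ 2 * ({e | X.arc e.1 e.2} : Finset (X.V × X.V)).card := by
  classical
  have h1 : ({e | X.G.Adj e.1 e.2} : Finset (X.V × X.V)) ⊆
      ({e | X.arc e.1 e.2} : Finset (X.V × X.V)) ∪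
        ({e | X.arc e.1 e.2} : Finset (X.V × X.V)).image Prod.swap := by
    intro e he
    simp only [Finset.mem_filter, Finset.mem_univ, true_and, Finset.mem_union,
      Finset.mem_image] at he ⊢
    rcases le_total (X.deg e.2) (X.deg e.1) with h | h
    · exact Or.inl ⟨he, h⟩
    · exact Or.inr ⟨e.swap, ⟨he.symm, h⟩, Prod.swap_swap e⟩
  have h2 := (Finset.card_le_card h1).trans (Finset.card_union_le _ _)
  have h3 := Finset.card_image_le (s := ({e | X.arc e.1 e.2} : Finset (X.V × X.V)))
    (f := Prod.swap)
  rw [size]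
  omega

/-- Arcs that form paths and cycles and have large weight. -/
def pathArcs (X : Net.{u}) (K : ℕ) : X.V → X.V → Prop := X.arcsAt (4 * K) K K

theorem pathArcs_arc {v u : X.V} (h : X.pathArcs K v u) : X.arc v u := arcsAt_le _ _ _ _ _ h

theorem pathArcs_out_unique (hK : ∀ v, X.level v ≤ K) {v u w : X.V} (h : X.pathArcs K v u)
    (h' : X.pathArcs K v w) : u = w := by
  classical
  have h1 := sum_arcsAt_out_le (r := 4 * K) hK K le_rfl v
  simp only [Nat.sub_self, Nat.zero_sub, pow_zero, Finset.sum_const, smul_eq_mul, mul_one] at h1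
  exact Finset.card_le_one.1 h1 u (by simpa using! h) w (by simpa using! h')

theorem pathArcs_in_unique (hK : ∀ v, X.level v ≤ K) {v w u : X.V} (h : X.pathArcs K v u)
    (h' : X.pathArcs K w u) : v = w := by
  classical
  have h1 := sum_arcsAt_in_le (r := 4 * K) hK K le_rfl u
  simp only [Nat.sub_self, Nat.zero_sub, pow_zero, Finset.sum_const, smul_eq_mul, mul_one] at h1
  exact Finset.card_le_one.1 h1 v (by simpa using! h) w (by simpa using! h')

-- Three factors of 2 are lost: in choosing a direction, in rounding degrees to powers of two, and
-- in the K roundings.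
open Classical in
theorem size_le_sum_pathArcs (hK0 : 1 ≤ K) (hK : ∀ v, X.level v ≤ K) :
    X.size ≤ 8 * ∑ e : X.V × X.V with X.pathArcs K e.1 e.2, X.deg e.1 := by
  have h1 := size_le_card_arc (X := X)
  have h2 := card_arc_le (X := X) (r := 4 * K) hK
  have h3 := arcWeight_zero_le (X := X) hK0
  have h4 : X.arcWeight (4 * K) K K = ∑ e : X.V × X.V with X.pathArcs K e.1 e.2, X.deg e.1 := by
    rw [arcWeight]
    simp only [Nat.sub_self, Nat.zero_sub, pow_zero, mul_one]
    rfl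
  rw [← h4]
  have h5 : 0 < 2 ^ K := by positivity
  have h6 : 2 ^ K * ({e | X.arc e.1 e.2} : Finset (X.V × X.V)).card
      ≤ 2 ^ K * (4 * X.arcWeight (4 * K) K K) := by
    calc _ ≤ _ := h2
      _ ≤ 2 * (2 * 2 ^ K * X.arcWeight (4 * K) K K) := by omega
      _ = _ := by ring
  have h7 := Nat.le_of_mul_le_mul_left h6 h5
  omega

end

theorem relSim_arc : RelSim X Y 2 X.arc Y.arc :=
  (relSim_adj.mono (by norm_num)).and_adj (s := 1) le_rfl (fun _ _ h => h) (fun _ _ h => h)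
    fun v v' u u' h1 h2 => by rw [funSim_deg _ _ h1, funSim_deg _ _ h2]

theorem funSim_level : FunSim X Y 1 X.level Y.level := fun v v' h => by
  rw [level, level, funSim_deg _ _ h]

theorem relSim_arcsAt (r K j : ℕ) :
    RelSim X Y (j * (2 * r + 4) + 1 + 1) (X.arcsAt r K j) (Y.arcsAt r K j) := by
  induction j with
  | zero => exact relSim_arc.mono (by omega)
  | succ j ih =>
    have h1 : FunSim X Y (j * (2 * r + 4) + 1 + 1) (fun v => X.level v < K - j)
        (fun v => Y.level v < K - j) := fun v v' h => by
      dsimp only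
      rw [funSim_level _ _ (h.mono (by omega))]
    have h2 : FunSim X Y (j * (2 * r + 4) + 1 + 1) (fun v => K - j ≤ X.level v)
        (fun v => K - j ≤ Y.level v) := fun v v' h => by
      dsimp only
      rw [funSim_level _ _ (h.mono (by omega))]
    have h3 := (ih.and_left h2).rounded (r := r) (fun v u h => arcsAt_adj r K j v u h.1)
      (fun v u h => arcsAt_adj r K j v u h.1)
    exact (((ih.and_left h1).mono (by omega)).or h3).mono (by rw [Nat.succ_mul]; ring_nf; omega)

end Net

namespace Net

variable {X Y : Net.{u}}

/-! ### Colour reduction -/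

/-- The colours after `s` rounds of colour reduction on the graph `Q` of maximum degree `d`, when
the initial colours have `k` binary digits. -/
noncomputable def reducedCol (X : Net.{u}) (Q : X.V → X.V → Prop) (d k : ℕ) : ℕ → X.V → ℕ
  | 0 => X.col
  | s + 1 => fun v => open Classical in
    recolour d ((nextBits d)^[s] k) (reducedCol X Q d k s v)
      (({u | Q v u} : Finset X.V).image (reducedCol X Q d k s))

open Classical in
theorem reducedCol_spec {Q : X.V → X.V → Prop} {d k : ℕ}
    (hd : ∀ v, ({u | Q v u} : Finset X.V).card ≤ d) (hk : ∀ v, X.col v < 2 ^ k)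
    (hcol : ∀ v u, Q v u → X.col v ≠ X.col u) (s : ℕ) :
    (∀ v, X.reducedCol Q d k s v < 2 ^ (nextBits d)^[s] k) ∧
      ∀ v u, Q v u → X.reducedCol Q d k s v ≠ X.reducedCol Q d k s u := by
  induction s with
  | zero => exact ⟨hk, hcol⟩
  | succ s ih =>
    obtain ⟨h1, h2⟩ := ih
    have h3 : ∀ v, ∀ y ∈ ({u | Q v u} : Finset X.V).image (X.reducedCol Q d k s),
        y < 2 ^ (nextBits d)^[s] k := by
      intro v y hy
      obtain ⟨u, -, rfl⟩ := Finset.mem_image.1 hy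
      exact h1 u
    have h4 : ∀ v, X.reducedCol Q d k s v ∉
        ({u | Q v u} : Finset X.V).image (X.reducedCol Q d k s) := by
      intro v hv
      obtain ⟨u, hu, h⟩ := Finset.mem_image.1 hv
      simp only [Finset.mem_filter, Finset.mem_univ, true_and] at hu
      exact h2 v u hu h.symm
    have h5 : ∀ v, (({u | Q v u} : Finset X.V).image (X.reducedCol Q d k s)).card ≤ d :=
      fun v => Finset.card_image_le.trans (hd v)
    refine ⟨fun v => ?_, fun v u hvu => ?_⟩
    · rw [Function.iterate_succ_apply']
      exact recolour_lt (h1 v) (h3 v) (h4 v) (h5 v)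
    · refine recolour_ne (h1 v) (h3 v) (h4 v) (h5 v) (h1 u) (h3 u) (h4 u) (h5 u) ?_
      exact Finset.mem_image_of_mem _ (by simpa using hvu)

theorem funSim_reducedCol {Q : X.V → X.V → Prop} {Q' : Y.V → Y.V → Prop} {t : ℕ}
    (hQ : RelSim X Y (t + 1) Q Q') (hQG : ∀ v u, Q v u → X.G.Adj v u)
    (hQG' : ∀ v u, Q' v u → Y.G.Adj v u) (d k s : ℕ) :
    FunSim X Y (t + 1 + s) (X.reducedCol Q d k s) (Y.reducedCol Q' d k s) := by
  induction s with
  | zero => exact fun v v' h => h.col_eq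
  | succ s ih =>
    intro v v' h
    have h' : Sim X Y (t + 1) v v' := h.mono (by omega)
    simp only [reducedCol]
    rw [ih v v' (h.mono (by omega))]
    congr 1
    ext y
    simp only [Finset.mem_image, Finset.mem_filter, Finset.mem_univ, true_and]
    constructor
    · rintro ⟨u, h1, rfl⟩
      obtain ⟨u', -, h2⟩ := Sim.exists_adj (t := t + 1 + s) h (hQG _ _ h1)
      exact ⟨u', (hQ v v' u u' h' h2.ident_eq).1 h1, (ih u u' h2).symm⟩
    · rintro ⟨u, h1, rfl⟩
      obtain ⟨u', -, h2⟩ := Sim.exists_adj (t := t + 1 + s) h.symm (hQG' _ _ h1)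
      exact ⟨u', (hQ v v' u' u h' h2.ident_eq.symm).2 h1, ih u' u h2.symm⟩

/-! ### Matchings given by directed edges -/

/-- `x` is an endpoint of an arc in `M`. -/
def Touched {V : Type*} (M : V → V → Prop) (x : V) : Prop := ∃ y, M x y ∨ M y x

/-- Different arcs in `M` are disjoint. -/
def IsArcMatching {V : Type*} (M : V → V → Prop) : Prop :=
  ∀ v u v' u', M v u → M v' u' → (v = v' ∨ v = u' ∨ u = v' ∨ u = u') → v = v' ∧ u = u'

theorem Touched.left {V : Type*} {M : V → V → Prop} {v u : V} (h : M v u) : Touched M v :=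
  ⟨u, Or.inl h⟩

theorem Touched.right {V : Type*} {M : V → V → Prop} {v u : V} (h : M v u) : Touched M u :=
  ⟨v, Or.inr h⟩

theorem RelSim.funSim_touched {M : X.V → X.V → Prop} {M' : Y.V → Y.V → Prop} {t : ℕ}
    (hM : RelSim X Y (t + 1) M M') (hMG : ∀ v u, M v u → X.G.Adj v u)
    (hMG' : ∀ v u, M' v u → Y.G.Adj v u) :
    FunSim X Y (t + 2) (Touched M) (Touched M') := by
  refine RelSim.funSim_exists (t := t + 1) ((hM.mono (by omega)).or (hM.flip hMG hMG')) ?_ ?_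
  · rintro v u (h | h)
    exacts [hMG _ _ h, (hMG _ _ h).symm]
  · rintro v u (h | h)
    exacts [hMG' _ _ h, (hMG' _ _ h).symm]

/-- The matching that is built on the paths and cycles formed by `P`: first the initial arcs of the
paths are taken, and then the colour classes of the tails are treated one after the other. -/
def greedy {V : Type*} (P : V → V → Prop) (c : V → ℕ) : ℕ → V → V → Prop
  | 0 => fun v u => P v u ∧ ¬ ∃ t, P t v
  | j + 1 => fun v u => greedy P c j v u ∨
      P v u ∧ c v = j ∧ ¬ Touched (greedy P c j) v ∧ ¬ Touched (greedy P c j) u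

section

variable {V : Type*} {P : V → V → Prop} {c : V → ℕ}

theorem greedy_le (j : ℕ) {v u : V} (h : greedy P c j v u) : P v u := by
  induction j with
  | zero => exact h.1
  | succ j ih =>
    rcases h with h | h
    exacts [ih h, h.1]

theorem greedy_mono {i j : ℕ} (hij : i ≤ j) {v u : V} (h : greedy P c i v u) :
    greedy P c j v u := by
  induction hij with
  | refl => exact h
  | step _ ih => exact Or.inl ih

theorem Touched.mono {M N : V → V → Prop} (hMN : ∀ v u, M v u → N v u) {x : V}
    (h : Touched M x) : Touched N x := by
  obtain ⟨y, h | h⟩ := h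
  exacts [⟨y, Or.inl (hMN _ _ h)⟩, ⟨y, Or.inr (hMN _ _ h)⟩]

/-- Arcs added together have tails of the same colour. Distinct arcs of `P` that meet are
consecutive, so their tails are adjacent in `P` and coloured differently. Initial arcs are never
consecutive. -/
theorem greedy_isArcMatching (hout : ∀ v u w, P v u → P v w → u = w)
    (hin : ∀ v w u, P v u → P w u → v = w) (hc : ∀ v u, P v u → c v ≠ c u) (j : ℕ) :
    IsArcMatching (greedy P c j) := by
  induction j with
  | zero =>
    rintro v u v' u' ⟨h1, h2⟩ ⟨h3, h4⟩ (rfl | rfl | rfl | rfl)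
    · exact ⟨rfl, hout _ _ _ h1 h3⟩
    · exact absurd ⟨_, h3⟩ h2
    · exact absurd ⟨_, h1⟩ h4
    · exact ⟨hin _ _ _ h1 h3, rfl⟩
  | succ j ih =>
    rintro v u v' u' (h1 | ⟨h1, h2, h3, h4⟩) (h5 | ⟨h5, h6, h7, h8⟩) h
    · exact ih _ _ _ _ h1 h5 h
    · rcases h with rfl | rfl | rfl | rfl
      · exact absurd (Touched.left h1) h7
      · exact absurd (Touched.left h1) h8
      · exact absurd (Touched.right h1) h7
      · exact absurd (Touched.right h1) h8
    · rcases h with rfl | rfl | rfl | rfl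
      · exact absurd (Touched.left h5) h3
      · exact absurd (Touched.right h5) h3
      · exact absurd (Touched.left h5) h4
      · exact absurd (Touched.right h5) h4
    · rcases h with rfl | rfl | rfl | rfl
      · exact ⟨rfl, hout _ _ _ h1 h5⟩
      · exact absurd (h6.trans h2.symm) (hc _ _ h5)
      · exact absurd (h2.trans h6.symm) (hc _ _ h1)
      · exact ⟨hin _ _ _ h1 h5, rfl⟩

theorem greedy_maximal {j : ℕ} {v u : V} (h : P v u) (hj : c v < j) :
    Touched (greedy P c j) v ∨ Touched (greedy P c j) u := by
  by_contra hcon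
  rw [not_or] at hcon
  have hm : ∀ x, Touched (greedy P c (c v)) x → Touched (greedy P c j) x := fun x hx =>
    hx.mono fun _ _ => greedy_mono hj.le
  have h1 : greedy P c (c v + 1) v u :=
    Or.inr ⟨h, rfl, fun h2 => hcon.1 (hm _ h2), fun h2 => hcon.2 (hm _ h2)⟩
  exact hcon.1 (Touched.left (greedy_mono hj h1))

open Classical in
/-- If the weights do not increase along the arcs, the nodes that are matched have at least half of
the weight of the tails. -/
theorem sum_le_two_mul_sum_touched [Fintype V] (hout : ∀ v u w, P v u → P v w → u = w)
    {q : ℕ} (hc : ∀ v, c v < q) (w : V → ℕ)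
    (hw : ∀ v u, P v u → w u ≤ w v) :
    ∑ e : V × V with P e.1 e.2, w e.1 ≤ 2 * ∑ v with Touched (greedy P c q) v, w v := by
  set T : V → Prop := Touched (greedy P c q) with hT
  have hsplit : ∑ e : V × V with P e.1 e.2, w e.1
      = ∑ e : V × V with P e.1 e.2 ∧ T e.1, w e.1 + ∑ e : V × V with P e.1 e.2 ∧ ¬ T e.1, w e.1 := by
    simp only [← Finset.filter_filter]
    exact (Finset.sum_filter_add_sum_filter_not _ (fun e : V × V => T e.1) _).symm
  -- Because initial arcs are taken first, an unmatched tail has a predecessor, which is matched by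
  -- maximality and weighs at least as much. Predecessors of different nodes differ by `hout`.
  have hpred : ∀ v u, P v u → ¬ T v → ∃ t, P t v ∧ T t := by
    intro v u h1 h2
    have h3 : ∃ t, P t v := by
      by_contra h3
      exact h2 (Touched.left (greedy_mono (Nat.zero_le q) (⟨h1, h3⟩ : greedy P c 0 v u)))
    obtain ⟨t, ht⟩ := h3
    exact ⟨t, ht, (greedy_maximal ht (hc t)).resolve_right h2⟩
  have hex : ∀ v, ∃ t, (∃ u, P v u) → ¬ T v → P t v ∧ T t := by
    intro v
    by_cases h : (∃ u, P v u) ∧ ¬ T v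
    · obtain ⟨⟨u, h1⟩, h2⟩ := h
      obtain ⟨t, ht⟩ := hpred v u h1 h2
      exact ⟨t, fun _ _ => ht⟩
    · exact ⟨v, fun h1 h2 => absurd ⟨h1, h2⟩ h⟩
  choose p hp using hex
  rw [hsplit, two_mul]
  refine Nat.add_le_add ?_ ?_
  · rw [← Finset.sum_image (f := w) (g := fun e : V × V => e.1)]
    · refine Finset.sum_le_sum_of_subset fun v hv => ?_
      obtain ⟨e, he, rfl⟩ := Finset.mem_image.1 hv
      simp only [Finset.mem_filter, Finset.mem_univ, true_and] at he ⊢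
      exact he.2
    · intro e he e' he' h
      simp only [Finset.coe_filter, Finset.mem_univ, true_and, Set.mem_ofPred_eq] at he he' h
      refine Prod.ext h (hout _ _ _ he.1 ?_)
      rw [h]; exact he'.1
  · have h1 : ∑ e : V × V with P e.1 e.2 ∧ ¬ T e.1, w e.1
        ≤ ∑ e : V × V with P e.1 e.2 ∧ ¬ T e.1, w (p e.1) := by
      refine Finset.sum_le_sum fun e he => ?_
      simp only [Finset.mem_filter, Finset.mem_univ, true_and] at he
      exact hw _ _ (hp e.1 ⟨_, he.1⟩ he.2).1
    refine h1.trans ?_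
    rw [← Finset.sum_image (f := w) (g := fun e : V × V => p e.1)]
    · refine Finset.sum_le_sum_of_subset fun v hv => ?_
      obtain ⟨e, he, rfl⟩ := Finset.mem_image.1 hv
      simp only [Finset.mem_filter, Finset.mem_univ, true_and] at he ⊢
      exact (hp e.1 ⟨_, he.1⟩ he.2).2
    · intro e he e' he' h
      simp only [Finset.coe_filter, Finset.mem_univ, true_and, Set.mem_ofPred_eq] at he he' h
      have h2 := (hp e.1 ⟨_, he.1⟩ he.2).1
      have h3 := (hp e'.1 ⟨_, he'.1⟩ he'.2).1
      rw [h] at h2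
      have h4 := hout _ _ _ h2 h3
      refine Prod.ext h4 (hout _ _ _ he.1 ?_)
      rw [h4]; exact he'.1

end

theorem relSim_greedy {P : X.V → X.V → Prop} {P' : Y.V → Y.V → Prop} {c : X.V → ℕ} {c' : Y.V → ℕ}
    {t s : ℕ} (hP : RelSim X Y (t + 1) P P') (hPG : ∀ v u, P v u → X.G.Adj v u)
    (hPG' : ∀ v u, P' v u → Y.G.Adj v u) (hc : FunSim X Y (t + 2 + s) c c') (j : ℕ) :
    RelSim X Y (t + 2 + s + 2 * j) (greedy P c j) (greedy P' c' j) := by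
  induction j with
  | zero =>
    have h1 : FunSim X Y (t + 2) (fun v => ¬ ∃ w, P w v) (fun v => ¬ ∃ w, P' w v) :=
      fun v v' h => by
        have := (hP.flip hPG hPG').funSim_exists (t := t + 1) (fun _ _ h => (hPG _ _ h).symm)
          (fun _ _ h => (hPG' _ _ h).symm) v v' h
        exact congrArg Not this
    exact ((hP.mono (by omega)).and_left h1).mono (by omega)
  | succ j ih =>
    have hG : ∀ v u, greedy P c j v u → X.G.Adj v u := fun _ _ h => hPG _ _ (greedy_le j h)
    have hG' : ∀ v u, greedy P' c' j v u → Y.G.Adj v u := fun _ _ h => hPG' _ _ (greedy_le j h)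
    have h1 := RelSim.funSim_touched (t := t + 1 + s + 2 * j) (ih.mono (by omega)) hG hG'
    refine (ih.mono (by omega)).or ?_
    refine RelSim.and_adj (s := t + 1 + s + 2 * j + 2) (by omega) (hP.mono (by omega)) hPG hPG' ?_
    intro v v' u u' h2 h3
    rw [hc v v' (h2.mono (by omega)), h1 v v' h2, h1 u u' h3]

/-! ### One phase -/

/-- Adjacency in the union of the paths and cycles. -/
def pathAdj (X : Net.{u}) (K : ℕ) (v u : X.V) : Prop := X.pathArcs K v u ∨ X.pathArcs K u v

/-- A matching that covers a constant fraction of the edges. -/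
noncomputable def phase (X : Net.{u}) (K k s : ℕ) : X.V → X.V → Prop :=
  greedy (X.pathArcs K) (X.reducedCol (X.pathAdj K) 2 k s) (2 ^ 10)

section

variable {K k s : ℕ}

theorem phase_arc {v u : X.V} (h : X.phase K k s v u) : X.arc v u :=
  pathArcs_arc (greedy_le _ h)

-- The paths carry at least 1/8 of `size` in degrees of tails, and the greedy matching retains half
-- of that.
open Classical in
theorem phase_spec (hK0 : 1 ≤ K) (hK : ∀ v, X.level v ≤ K) (hk : ∀ v, X.col v < 2 ^ k)
    (hcol : ∀ v u, X.G.Adj v u → X.col v ≠ X.col u) (hs : (nextBits 2)^[s] k ≤ 10) :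
    IsArcMatching (X.phase K k s) ∧
      X.size ≤ 16 * ∑ v with Touched (X.phase K k s) v, X.deg v := by
  have hout : ∀ v u w, X.pathArcs K v u → X.pathArcs K v w → u = w :=
    fun v u w h h' => pathArcs_out_unique hK h h'
  have hin : ∀ v w u, X.pathArcs K v u → X.pathArcs K w u → v = w :=
    fun v w u h h' => pathArcs_in_unique hK h h'
  have hadj : ∀ v u, X.pathAdj K v u → X.G.Adj v u := by
    rintro v u (h | h)
    exacts [(pathArcs_arc h).1, (pathArcs_arc h).1.symm]
  have hd : ∀ v, ({u | X.pathAdj K v u} : Finset X.V).card ≤ 2 := by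
    intro v
    have h1 : ({u | X.pathAdj K v u} : Finset X.V)
        ⊆ ({u | X.pathArcs K v u} : Finset X.V) ∪ ({u | X.pathArcs K u v} : Finset X.V) := by
      intro u hu
      simp only [Finset.mem_filter, Finset.mem_univ, true_and, Finset.mem_union] at hu ⊢
      exact hu
    have h2 : ({u | X.pathArcs K v u} : Finset X.V).card ≤ 1 :=
      Finset.card_le_one.2 fun u hu w hw => hout v u w (by simpa using hu) (by simpa using hw)
    have h3 : ({u | X.pathArcs K u v} : Finset X.V).card ≤ 1 :=
      Finset.card_le_one.2 fun u hu w hw => hin u w v (by simpa using hu) (by simpa using hw)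
    have h4 := (Finset.card_le_card h1).trans (Finset.card_union_le _ _)
    omega
  obtain ⟨h1, h2⟩ := reducedCol_spec (X := X) (Q := X.pathAdj K) (d := 2) (k := k)
    hd hk (fun v u h => hcol v u (hadj v u h)) s
  have h3 : ∀ v, X.reducedCol (X.pathAdj K) 2 k s v < 2 ^ 10 := fun v =>
    (h1 v).trans_le (Nat.pow_le_pow_right (by norm_num) hs)
  refine ⟨greedy_isArcMatching hout hin (fun v u h => h2 v u (Or.inl h)) _, ?_⟩
  have h4 := size_le_sum_pathArcs hK0 hK
  have h5 := sum_le_two_mul_sum_touched hout h3 X.deg (fun v u h => (pathArcs_arc h).2)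
  rw [phase]
  omega

/-- The number of rounds of a phase. -/
def phaseRounds (K s : ℕ) : ℕ := K * (8 * K + 4) + s + 2051

theorem relSim_phase : RelSim X Y (phaseRounds K s) (X.phase K k s) (Y.phase K k s) := by
  have h1 : RelSim X Y (K * (2 * (4 * K) + 4) + 1 + 1) (X.pathArcs K) (Y.pathArcs K) :=
    relSim_arcsAt (4 * K) K K
  have hG : ∀ v u, X.pathArcs K v u → X.G.Adj v u := fun v u h => (pathArcs_arc h).1
  have hG' : ∀ v u, Y.pathArcs K v u → Y.G.Adj v u := fun v u h => (pathArcs_arc h).1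
  have h2 := (h1.mono (Nat.le_succ _)).or (h1.flip hG hG')
  have h3 := funSim_reducedCol h2 (by rintro v u (h | h); exacts [hG _ _ h, (hG _ _ h).symm])
    (by rintro v u (h | h); exacts [hG' _ _ h, (hG' _ _ h).symm]) 2 k s
  -- Two rounds for each of the 2^10 colour classes and three further rounds give the constant 2051.
  refine (relSim_greedy h1 hG hG' (s := s) h3 (2 ^ 10)).mono ?_
  rw [phaseRounds]
  ring_nf
  omega

end

/-! ### Iterating the phases -/

/-- The network without the edges at nodes that are touched by `M`, and with new colours. -/
abbrev prune (X : Net.{u}) (M : X.V → X.V → Prop) (c : X.V → ℕ) : Net.{u} where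
  V := X.V
  fintypeV := X.fintypeV
  G :=
    { Adj := fun v u => X.G.Adj v u ∧ ¬ Touched M v ∧ ¬ Touched M u
      symm := ⟨fun _ _ h => ⟨h.1.symm, h.2.2, h.2.1⟩⟩
      loopless := ⟨fun _ h => h.1.ne rfl⟩ }
  ident := X.ident
  ident_injective := X.ident_injective
  col := c

/-- Nodes can simulate the pruned network once they know whether they are matched, so the radii of
successive phases add up. -/
theorem Sim.prune {M : X.V → X.V → Prop} {M' : Y.V → Y.V → Prop} {c : X.V → ℕ} {c' : Y.V → ℕ}
    {t : ℕ} (hM : RelSim X Y (t + 1) M M') (hMG : ∀ v u, M v u → X.G.Adj v u)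
    (hMG' : ∀ v u, M' v u → Y.G.Adj v u) (hc : FunSim X Y (t + 2) c c') {n : ℕ} {v : X.V}
    {v' : Y.V} (h : Sim X Y (t + 2 + n) v v') : Sim (X.prune M c) (Y.prune M' c') n v v' := by
  have hT := hM.funSim_touched hMG hMG'
  induction n generalizing v v' with
  | zero => exact ⟨h.ident_eq, hc v v' h⟩
  | succ n ih =>
    refine ⟨ih (h.mono (by omega)), ?_, ?_⟩
    · rintro u ⟨h1, h2, h3⟩
      obtain ⟨u', h4, h5⟩ := Sim.exists_adj (t := t + 2 + n) h h1
      rw [hT v v' (h.mono (by omega))] at h2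
      rw [hT u u' (h5.mono (by omega))] at h3
      exact ⟨u', ⟨h4, h2, h3⟩, ih h5⟩
    · rintro u' ⟨h1, h2, h3⟩
      obtain ⟨u, h4, h5⟩ := Sim.exists_adj (t := t + 2 + n) h.symm h1
      rw [← hT v v' (h.mono (by omega))] at h2
      rw [← hT u u' (h5.symm.mono (by omega))] at h3
      exact ⟨u, ⟨h4, h2, h3⟩, ih h5.symm⟩

/-- The matching that is found in the first `j` phases, each on the nodes that are still free. -/
noncomputable def matchAt (X : Net.{u}) (K k s : ℕ) (c : X.V → ℕ) : ℕ → X.V → X.V → Prop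
  | 0 => fun _ _ => False
  | j + 1 => fun v u => matchAt X K k s c j v u ∨
      (X.prune (matchAt X K k s c j) c).phase K k s v u

section

variable {K k s : ℕ} {c : X.V → ℕ}

theorem matchAt_adj (j : ℕ) (v u : X.V) (h : X.matchAt K k s c j v u) : X.G.Adj v u := by
  induction j with
  | zero => exact h.elim
  | succ j ih =>
    rcases h with h | h
    · exact ih h
    · exact (phase_arc h).1.1

theorem relSim_matchAt {c' : Y.V → ℕ} {t : ℕ} (hc : FunSim X Y (t + 1) c c') (j : ℕ) :
    RelSim X Y (t + 1 + j * (phaseRounds K s + 1)) (X.matchAt K k s c j)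
      (Y.matchAt K k s c' j) := by
  induction j with
  | zero => exact fun _ _ _ _ _ _ => Iff.rfl
  | succ j ih =>
    rw [Nat.succ_mul]
    set m := j * (phaseRounds K s + 1) with hm
    refine (ih.mono (by omega)).or fun v v' u u' h1 h2 => ?_
    have h3 : Sim (X.prune (X.matchAt K k s c j) c) (Y.prune (Y.matchAt K k s c' j) c')
        (phaseRounds K s) v v' :=
      Sim.prune (t := t + m) (n := phaseRounds K s) (ih.mono (by omega)) (matchAt_adj j)
        (matchAt_adj j) (hc.mono (by omega)) (h1.mono (by omega))
    exact relSim_phase (X := X.prune (X.matchAt K k s c j) c)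
      (Y := Y.prune (Y.matchAt K k s c' j) c') v v' u u' h3 h2

open Classical in
theorem size_eq_sum_deg : X.size = ∑ v, X.deg v := by
  simp only [size, deg_eq]
  rw [Finset.card_filter, ← Finset.univ_product_univ, Finset.sum_product]
  exact Finset.sum_congr rfl fun v _ => by rw [Finset.card_filter]

-- A touched node loses its entire degree, and no degree grows.
open Classical in
theorem size_prune_add_le (M : X.V → X.V → Prop) (c : X.V → ℕ) :
    (X.prune M c).size + ∑ v with Touched M v, X.deg v ≤ X.size := by
  rw [size_eq_sum_deg, size_eq_sum_deg, Finset.sum_filter, ← Finset.sum_add_distrib]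
  refine Finset.sum_le_sum fun v _ => ?_
  rw [deg_eq, deg_eq]
  by_cases h : Touched M v
  · simp [h]
  · simp only [h, if_false, add_zero, not_false_eq_true, true_and]
    refine Finset.card_le_card fun u hu => ?_
    simp only [Finset.mem_filter, Finset.mem_univ, true_and] at hu ⊢
    exact hu.1

theorem size_prune_prune {M N : X.V → X.V → Prop} (c : X.V → ℕ) :
    ((X.prune M c).prune N c).size = (X.prune (fun v u => M v u ∨ N v u) c).size := by
  simp only [size]
  congr 1
  ext e
  have h : ∀ x, Touched (fun v u => M v u ∨ N v u) x ↔ Touched M x ∨ Touched N x := by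
    intro x
    simp only [Touched]
    constructor
    · rintro ⟨y, (h | h) | (h | h)⟩
      exacts [Or.inl ⟨y, Or.inl h⟩, Or.inr ⟨y, Or.inl h⟩, Or.inl ⟨y, Or.inr h⟩,
        Or.inr ⟨y, Or.inr h⟩]
    · rintro (⟨y, h | h⟩ | ⟨y, h | h⟩)
      exacts [⟨y, Or.inl (Or.inl h)⟩, ⟨y, Or.inr (Or.inl h)⟩, ⟨y, Or.inl (Or.inr h)⟩,
        ⟨y, Or.inr (Or.inr h)⟩]
  simp only [h, Finset.mem_filter]
  tauto

theorem level_prune_le (M : X.V → X.V → Prop) (v : X.V) : (X.prune M c).level v ≤ X.level v := by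
  classical
  refine Nat.clog_mono_right 2 ?_
  rw [deg_eq, deg_eq]
  refine Finset.card_le_card fun u hu => ?_
  simp only [Finset.mem_filter, Finset.mem_univ, true_and] at hu ⊢
  exact hu.1

/-- The phases find a matching, and each of them covers a constant fraction of the edges that are
left. -/
theorem matchAt_spec (hK0 : 1 ≤ K) (hK : ∀ v, X.level v ≤ K) (hk : ∀ v, c v < 2 ^ k)
    (hcol : ∀ v u, X.G.Adj v u → c v ≠ c u) (hs : (nextBits 2)^[s] k ≤ 10) (j : ℕ) :
    IsArcMatching (X.matchAt K k s c j) ∧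
      16 ^ j * (X.prune (X.matchAt K k s c j) c).size ≤ 15 ^ j * X.size := by
  classical
  induction j with
  | zero =>
    refine ⟨fun _ _ _ _ h => h.elim, ?_⟩
    simp only [pow_zero, one_mul]
    exact (Nat.le_add_right _ _).trans (size_prune_add_le _ _)
  | succ j ih =>
    obtain ⟨ih1, ih2⟩ := ih
    set M := X.matchAt K k s c j with hM
    obtain ⟨h1, h2⟩ := phase_spec (X := X.prune M c) (s := s) hK0
      (fun v => (level_prune_le M v).trans (hK v)) hk (fun v u h => hcol v u h.1) hs
    have h3 : ∀ v u, (X.prune M c).phase K k s v u → ¬ Touched M v ∧ ¬ Touched M u :=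
      fun v u h => (phase_arc h).1.2
    refine ⟨?_, ?_⟩
    · rintro v u v' u' (h4 | h4) (h5 | h5) h
      · exact ih1 _ _ _ _ h4 h5 h
      · exfalso
        obtain ⟨h6, h7⟩ := h3 _ _ h5
        rcases h with rfl | rfl | rfl | rfl
        exacts [h6 (Touched.left h4), h7 (Touched.left h4), h6 (Touched.right h4),
          h7 (Touched.right h4)]
      · exfalso
        obtain ⟨h6, h7⟩ := h3 _ _ h4
        rcases h with rfl | rfl | rfl | rfl
        exacts [h6 (Touched.left h5), h6 (Touched.right h5), h7 (Touched.left h5),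
          h7 (Touched.right h5)]
      · exact h1 _ _ _ _ h4 h5 h
    · have h4 := size_prune_add_le (X := X.prune M c) ((X.prune M c).phase K k s) c
      have h5 : (X.prune (X.matchAt K k s c (j + 1)) c).size
          = ((X.prune M c).prune ((X.prune M c).phase K k s) c).size :=
        (size_prune_prune c).symm
      rw [h5]
      have h6 : 16 * ((X.prune M c).prune ((X.prune M c).phase K k s) c).size
          ≤ 15 * (X.prune M c).size := by omega
      calc _ = 16 ^ j * (16 * ((X.prune M c).prune ((X.prune M c).phase K k s) c).size) := by ring
        _ ≤ 16 ^ j * (15 * (X.prune M c).size) := Nat.mul_le_mul_left _ h6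
        _ = 15 * (16 ^ j * (X.prune M c).size) := by ring
        _ ≤ 15 * (15 ^ j * X.size) := Nat.mul_le_mul_left _ ih2
        _ = _ := by ring

end

end Net

/-! ### The number of colour reduction steps -/

theorem exists_iterate_logb_le_one (x : ℝ) : ∃ k : ℕ, (Real.logb 2)^[k] x ≤ 1 := by
  obtain ⟨n, hn⟩ := exists_nat_ge x
  induction n using Nat.strong_induction_on generalizing x with
  | _ n ih =>
    rcases le_or_gt x 1 with h1 | h1
    · exact ⟨0, h1⟩
    rcases le_or_gt x 2 with h2 | h2
    · refine ⟨1, ?_⟩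
      have := Real.logb_le_logb_of_le (b := 2) (by norm_num) (by linarith) h2
      rwa [Real.logb_self_eq_one (by norm_num)] at this
    · have hn2 : 2 < n := by exact_mod_cast h2.trans_le hn
      have h3 : Real.logb 2 x ≤ ((n - 1 : ℕ) : ℝ) := by
        rw [Real.logb_le_iff_le_rpow (by norm_num) (by linarith), Real.rpow_natCast]
        refine hn.trans ?_
        have h4 : n ≤ 2 ^ (n - 1) := by
          have := Nat.lt_two_pow_self (n := n - 1)
          omega
        exact_mod_cast h4
      obtain ⟨k, hk⟩ := ih (n - 1) (by omega) _ h3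
      exact ⟨k + 1, by rwa [Function.iterate_succ_apply]⟩

theorem iterate_logStar_le_one (x : ℝ) : (Real.logb 2)^[logStar x] x ≤ 1 :=
  Nat.sInf_mem (s := {k : ℕ | (Real.logb 2)^[k] x ≤ 1}) (exists_iterate_logb_le_one x)

theorem one_lt_iterate_of_lt_logStar {x : ℝ} {k : ℕ} (h : k < logStar x) :
    1 < (Real.logb 2)^[k] x := by
  by_contra hk
  exact Nat.notMem_of_lt_sInf h (not_lt.1 hk)

theorem one_le_logStar {x : ℝ} (hx : 1 < x) : 1 ≤ logStar x := by
  by_contra h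
  have h0 : logStar x = 0 := by omega
  have := iterate_logStar_le_one x
  rw [h0] at this
  exact absurd hx (not_lt.2 this)

theorem clog_two_le {m : ℕ} (hm : 1 ≤ m) : (Nat.clog 2 m : ℝ) ≤ Real.logb 2 m + 1 := by
  have h := Real.natCeil_logb_natCast 2 m
  rw [← h]
  push_cast
  exact (Nat.ceil_lt_add_one (Real.logb_nonneg (by norm_num) (by exact_mod_cast hm))).le

/-- The factor E = 2^(4 + c + 2K) is reproduced by a reduction step: taking the logarithm of 8Ey
leaves 2^K (8 + c + 2K + log₂ y), and 2^K (8 + c + 2K) ≤ E. Thus the numbers of digits follow the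
iterated logarithms of `n`. -/
theorem nextBits_le {c K k : ℕ} {y : ℝ} (hy : 1 < y) (hk : (k : ℝ) ≤ 2 ^ (4 + c + 2 * K) * (y + 1)) :
    (nextBits (2 ^ K) k : ℝ) ≤ 2 ^ (4 + c + 2 * K) * (Real.logb 2 y + 1) := by
  set E : ℝ := 2 ^ (4 + c + 2 * K) with hE
  have hE1 : 1 ≤ E := one_le_pow₀ (by norm_num)
  have h1 : ((2 * k + 1 : ℕ) : ℝ) ≤ 2 ^ 3 * E * y := by
    push_cast
    nlinarith
  have h2 : Real.logb 2 ((2 * k + 1 : ℕ) : ℝ) ≤ 3 + (4 + c + 2 * K) + Real.logb 2 y := by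
    have h3 : (0 : ℝ) < ((2 * k + 1 : ℕ) : ℝ) := by positivity
    refine (Real.logb_le_logb_of_le (by norm_num) h3 h1).trans_eq ?_
    rw [Real.logb_mul (by positivity) (by linarith), Real.logb_mul (by positivity) (by positivity),
      hE, Real.logb_pow, Real.logb_pow, Real.logb_self_eq_one (by norm_num)]
    push_cast
    ring
  have h4 := clog_two_le (m := 2 * k + 1) (by omega)
  have h5 : 0 ≤ Real.logb 2 y := Real.logb_nonneg (by norm_num) hy.le
  have h6 : (2 : ℝ) ^ K * (8 + c + 2 * K) ≤ E := by
    have h7 : 8 + c + 2 * K ≤ 2 ^ (4 + c + K) := by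
      have h8 : c < 2 ^ c := Nat.lt_two_pow_self
      have h9 : K < 2 ^ K := Nat.lt_two_pow_self
      rw [pow_add, pow_add]
      nlinarith
    have h8 : (2 : ℝ) ^ K * 2 ^ (4 + c + K) = E := by
      rw [hE, ← pow_add]
      congr 1
      ring
    rw [← h8]
    have h7' : (8 + c + 2 * K : ℝ) ≤ 2 ^ (4 + c + K) := by exact_mod_cast h7
    exact mul_le_mul_of_nonneg_left h7' (by positivity)
  have h7 : (2 : ℝ) ^ K ≤ E := by
    refine le_trans ?_ h6
    have : (0 : ℝ) < 2 ^ K := by positivity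
    nlinarith [(Nat.cast_nonneg c : (0 : ℝ) ≤ c), (Nat.cast_nonneg K : (0 : ℝ) ≤ K)]
  have h8 : (nextBits (2 ^ K) k : ℝ) = 2 ^ K * (Nat.clog 2 (2 * k + 1) : ℝ) := by
    rw [nextBits]
    push_cast
    ring
  rw [h8]
  calc (2 : ℝ) ^ K * (Nat.clog 2 (2 * k + 1) : ℝ)
      ≤ 2 ^ K * (8 + c + 2 * K + Real.logb 2 y) :=
        mul_le_mul_of_nonneg_left (by linarith) (by positivity)
    _ = 2 ^ K * (8 + c + 2 * K) + 2 ^ K * Real.logb 2 y := by ring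
    _ ≤ E + E * Real.logb 2 y := add_le_add h6 (mul_le_mul_of_nonneg_right h7 h5)
    _ = E * (Real.logb 2 y + 1) := by ring

theorem iterate_nextBits_le {n N c K : ℕ} (hn : 2 ≤ n) (hN0 : 1 ≤ N) (hN : N ≤ n ^ c) {t : ℕ}
    (ht : t + 1 ≤ logStar n) :
    (((nextBits (2 ^ K))^[t] (Nat.clog 2 N) : ℕ) : ℝ)
      ≤ 2 ^ (4 + c + 2 * K) * ((Real.logb 2)^[t + 1] n + 1) := by
  induction t with
  | zero =>
    have h1 := clog_two_le hN0
    have hn1 : (2 : ℝ) ≤ n := by exact_mod_cast hn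
    have h2 : Real.logb 2 N ≤ c * Real.logb 2 n := by
      rw [← Real.logb_pow]
      exact Real.logb_le_logb_of_le (by norm_num) (by exact_mod_cast hN0) (by exact_mod_cast hN)
    have h3 : 0 ≤ Real.logb 2 n := Real.logb_nonneg (by norm_num) (by linarith)
    have h4 : (c : ℝ) ≤ 2 ^ (4 + c + 2 * K) := by
      have h5 : c ≤ 2 ^ (4 + c + 2 * K) := Nat.lt_two_pow_self.le.trans
        (Nat.pow_le_pow_right (by norm_num) (by omega))
      exact_mod_cast h5
    have h5 : (1 : ℝ) ≤ 2 ^ (4 + c + 2 * K) := one_le_pow₀ (by norm_num)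
    simp only [Function.iterate_zero, id_eq, zero_add, Function.iterate_one]
    nlinarith
  | succ t ih =>
    rw [Function.iterate_succ_apply', Function.iterate_succ_apply' _ (t + 1)]
    exact nextBits_le (one_lt_iterate_of_lt_logStar (by omega)) (ih (by omega))

/-- The number of rounds needed to obtain few colours from identifiers smaller than `N`. -/
noncomputable def precolourRounds (c K N : ℕ) : ℕ :=
  sInf {t | (nextBits (2 ^ K))^[t] (Nat.clog 2 N) ≤ 2 ^ (5 + c + 2 * K)}

/-- Nodes do not know `n`, but `precolourRounds` depends only on `c`, `K` and `N`. The digit bound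
is already reached after `logStar n - 1` reductions, when the iterated logarithm of the estimate is
at most 1. -/
theorem precolourRounds_spec {n N c K : ℕ} (hn : 2 ≤ n) (hN0 : 1 ≤ N) (hN : N ≤ n ^ c) :
    precolourRounds c K N ≤ logStar n ∧
      (nextBits (2 ^ K))^[precolourRounds c K N] (Nat.clog 2 N) ≤ 2 ^ (5 + c + 2 * K) := by
  have h1 : 1 ≤ logStar n := one_le_logStar (by exact_mod_cast hn)
  obtain ⟨t, ht⟩ := Nat.exists_eq_add_of_le h1
  have h2 : t ∈ {t | (nextBits (2 ^ K))^[t] (Nat.clog 2 N) ≤ 2 ^ (5 + c + 2 * K)} := by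
    have h3 := iterate_nextBits_le (K := K) hn hN0 hN (t := t) (by omega)
    have h4 := iterate_logStar_le_one n
    rw [show t + 1 = logStar n by omega] at h3
    have h5 : (((nextBits (2 ^ K))^[t] (Nat.clog 2 N) : ℕ) : ℝ) ≤ 2 ^ (5 + c + 2 * K) := by
      calc _ ≤ _ := h3
        _ ≤ (2 : ℝ) ^ (4 + c + 2 * K) * 2 :=
          mul_le_mul_of_nonneg_left (by linarith) (by positivity)
        _ = _ := by rw [← pow_succ]; congr 1; ring
    exact_mod_cast h5
  exact ⟨(Nat.sInf_le h2).trans (by omega), Nat.sInf_mem ⟨t, h2⟩⟩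

theorem four_mul_add_five_le_two_pow (m : ℕ) (hm : 5 ≤ m) : 4 * m + 5 ≤ 2 ^ m := by
  induction m, hm using Nat.le_induction with
  | base => norm_num
  | succ m hm ih => rw [pow_succ]; omega

/-- Ten digits reproduce themselves, as 2⌈log₂ 21⌉ = 10; a larger number decreases by at least one.
-/
theorem nextBits_two_le (k : ℕ) : nextBits 2 k ≤ max 10 (k - 1) := by
  rcases le_or_gt k 10 with h | h
  · refine le_trans ?_ (le_max_left _ _)
    have : Nat.clog 2 (2 * k + 1) ≤ 5 := Nat.clog_le_of_le_pow (by omega)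
    rw [nextBits]; omega
  · refine le_trans ?_ (le_max_right _ _)
    have h1 := four_mul_add_five_le_two_pow ((k - 1) / 2) (by omega)
    have : Nat.clog 2 (2 * k + 1) ≤ (k - 1) / 2 := Nat.clog_le_of_le_pow (by omega)
    rw [nextBits]; omega

theorem iterate_nextBits_two_le (k s : ℕ) : (nextBits 2)^[s] k ≤ max 10 (k - s) := by
  induction s with
  | zero => simp
  | succ s ih =>
    rw [Function.iterate_succ_apply']
    have := nextBits_two_le ((nextBits 2)^[s] k)
    omega

/-- The first step takes 2^m digits to at most 2m + 4, and then one digit per step suffices. With m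
= O(K) a phase needs only O(K) rounds for its colours. -/
theorem iterate_nextBits_two_pow_le (m : ℕ) : (nextBits 2)^[2 * m + 5] (2 ^ m) ≤ 10 := by
  rw [show 2 * m + 5 = (2 * m + 4) + 1 by ring, Function.iterate_succ_apply]
  have h1 : nextBits 2 (2 ^ m) ≤ 2 * m + 4 := by
    have : Nat.clog 2 (2 * 2 ^ m + 1) ≤ m + 2 := Nat.clog_le_of_le_pow (by
      have : 1 ≤ 2 ^ m := Nat.one_le_two_pow
      rw [pow_succ, pow_succ]; omega)
    rw [nextBits]; omega
  have h2 := iterate_nextBits_two_le (nextBits 2 (2 ^ m)) (2 * m + 4)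
  omega

/-! ### Gathering information in the `LOCAL` model -/

/-- What a node can know after some rounds. -/
inductive View : Type
  | leaf (i : ℕ) : View
  | node (v : View) (f : ℕ → Option View) : View

namespace Net

open Classical in
/-- What node `v` can know after `t` rounds. -/
noncomputable def view (X : Net.{u}) : ℕ → X.V → View
  | 0, v => View.leaf (X.ident v)
  | t + 1, v => View.node (view X t v) fun i =>
      if h : ∃ u, X.G.Adj v u ∧ X.ident u = i then some (view X t h.choose) else none

/-- Views record identifiers only, hence the restriction to networks coloured by identifiers. -/
theorem sim_of_view_eq {X Y : Net.{u}} (hX : X.col = X.ident) (hY : Y.col = Y.ident) {t : ℕ}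
    {v : X.V} {v' : Y.V} (h : X.view t v = Y.view t v') : Sim X Y t v v' := by
  have half : ∀ {X Y : Net.{u}} {t : ℕ} {v : X.V} {v' : Y.V},
      X.view (t + 1) v = Y.view (t + 1) v' → ∀ u, X.G.Adj v u →
        ∃ u', Y.G.Adj v' u' ∧ X.view t u = Y.view t u' := by
    intro X Y t v v' h u hu
    simp only [view, View.node.injEq] at h
    have h1 := congrFun h.2 (X.ident u)
    have hex : ∃ w, X.G.Adj v w ∧ X.ident w = X.ident u := ⟨u, hu, rfl⟩
    have hw : hex.choose = u := X.ident_injective hex.choose_spec.2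
    rw [dif_pos hex] at h1
    split_ifs at h1 with h2
    rw [hw] at h1
    exact ⟨_, h2.choose_spec.1, Option.some.inj h1⟩
  induction t generalizing v v' with
  | zero =>
    have h1 : X.ident v = Y.ident v' := View.leaf.inj h
    exact ⟨h1, by rw [hX, hY, h1]⟩
  | succ t ih =>
    refine ⟨ih (View.node.inj h).1, fun u hu => ?_, fun u' hu' => ?_⟩
    · obtain ⟨u', h1, h2⟩ := half h u hu
      exact ⟨u', h1, ih h2⟩
    · obtain ⟨u, h1, h2⟩ := half h.symm u' hu'
      exact ⟨u, h1, ih h2.symm⟩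

end Net

/-- The algorithm that gathers information for `T` rounds and then evaluates `F`. -/
noncomputable def gather (T : ℕ → ℝ → ℕ) (F : ℕ → ℝ → View → Finset ℕ) :
    LocalAlgorithm (Finset ℕ) where
  State := View × ℕ × ℕ × ℝ
  Msg := View
  init x := (View.leaf x.ident, 0, x.identBound, x.logDegreeEstimate)
  send s _ := s.1
  receive s m := (View.node s.1 m, s.2.1 + 1, s.2.2)
  output s := if s.2.1 = T s.2.2.1 s.2.2.2 then some (F s.2.2.1 s.2.2.2 s.1) else none

theorem stateAfter_gather (T : ℕ → ℝ → ℕ) (F : ℕ → ℝ → View → Finset ℕ) (X : Net.{u}) (N : ℕ)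
    (ℓ : ℝ) (t : ℕ) (ht : t ≤ T N ℓ) (v : X.V) :
    (gather T F).stateAfter X.G X.ident N ℓ t v = (X.view t v, t, N, ℓ) := by
  induction t generalizing v with
  | zero => rfl
  | succ t ih =>
    have ih := ih (by omega)
    have h1 : (gather T F).output ((gather T F).stateAfter X.G X.ident N ℓ t v) = none := by
      rw [ih]
      exact if_neg (by simp only; omega)
    rw [LocalAlgorithm.stateAfter, h1]
    simp only [funext ih]
    rw [Net.view]
    refine Prod.ext ?_ rfl
    change View.node _ _ = View.node _ _
    congr 1
    funext i
    by_cases h : ∃ u, X.G.Adj v u ∧ X.ident u = i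
    · rw [dif_pos h]
      exact dif_pos h
    · rw [dif_neg h]
      exact dif_neg h

/-- A function of the nodes that depends only on the neighbourhoods of radius `T` can be computed
in `T` rounds. -/
theorem exists_algorithm (T : ℕ → ℝ → ℕ) (f : ℕ → ℝ → ∀ X : Net.{u}, X.V → Finset ℕ)
    (hf : ∀ N ℓ X Y, Net.FunSim X Y (T N ℓ) (f N ℓ X) (f N ℓ Y)) :
    ∃ A : LocalAlgorithm (Finset ℕ), ∀ (X : Net.{u}) (N : ℕ) (ℓ : ℝ), X.col = X.ident →
      ∀ v, A.output (A.stateAfter X.G X.ident N ℓ (T N ℓ) v) = some (f N ℓ X v) := by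
  -- All nodes with the view `w`, in all networks, have the same value of `f`, so the output may be
  -- chosen as a function of the view. Local computation is unrestricted, so a mere choice suffices.
  have hex : ∀ N ℓ w, ∃ o : Finset ℕ, ∀ (X : Net.{u}) (v : X.V), X.col = X.ident →
      X.view (T N ℓ) v = w → f N ℓ X v = o := by
    intro N ℓ w
    by_cases h : ∃ (X : Net.{u}) (v : X.V), X.col = X.ident ∧ X.view (T N ℓ) v = w
    · obtain ⟨Y, v', hY, hw⟩ := h
      exact ⟨f N ℓ Y v', fun X v hX hv =>
        hf N ℓ X Y v v' (Net.sim_of_view_eq hX hY (hv.trans hw.symm))⟩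
    · exact ⟨∅, fun X v hX hv => absurd ⟨X, v, hX, hv⟩ h⟩
  choose F hF using hex
  refine ⟨gather T F, fun X N ℓ hX v => ?_⟩
  rw [stateAfter_gather T F X N ℓ _ le_rfl v]
  simp only [gather, if_true]
  rw [hF N ℓ _ X v hX rfl]

/-! ### The main algorithm and its round count -/

namespace Net

variable {X Y : Net.{u}}

theorem deg_eq_degree [DecidableRel X.G.Adj] (v : X.V) : X.deg v = X.G.degree v := by
  classical
  rw [deg_eq, ← SimpleGraph.card_neighborFinset_eq_degree]
  congr 1
  ext u
  simp

theorem size_eq_two_mul (X : Net.{u}) : X.size = 2 * X.G.edgeSet.ncard := by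
  classical
  rw [size_eq_sum_deg]
  simp only [deg_eq_degree]
  rw [SimpleGraph.sum_degrees_eq_twice_card_edges, Set.ncard_eq_toFinset_card']
  rfl

theorem size_eq_zero (h : ∀ v u, ¬ X.G.Adj v u) : X.size = 0 := by
  classical
  rw [size_eq_sum_deg]
  refine Finset.sum_eq_zero fun v _ => ?_
  simp [deg_eq, h]

/-- A matching that leaves few pairs of adjacent nodes uncovered is almost maximal. -/
theorem isEpsMaximalMatching_of_size {S : X.V → X.V → Prop} [Std.Symm S]
    (hSG : ∀ v u, S v u → X.G.Adj v u) (huniq : ∀ v u w, S v u → S v w → u = w) {c : X.V → ℕ}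
    {ε : ℝ} (hsize : ((X.prune S c).size : ℝ) ≤ ε * X.size) (M : Set (Sym2 X.V))
    (hM : ∀ v u, s(v, u) ∈ M ↔ S v u) :
    IsEpsMaximalMatching X.G ε M ∧
      ((unmatchedEdges X.G M).ncard : ℝ) ≤ ε * (X.G.edgeSet.ncard : ℝ) := by
  have hsym : ∀ v u, S v u → S u v := fun v u h => Std.Symm.symm v u h
  have hmem : ∀ e ∈ M, ∀ v ∈ e, ∃ u, e = s(v, u) ∧ S v u := by
    intro e he v hv
    obtain ⟨u, rfl⟩ := Sym2.mem_iff_exists.1 hv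
    exact ⟨u, rfl, (hM v u).1 he⟩
  have hun : unmatchedEdges X.G M = (X.prune S c).G.edgeSet := by
    ext e
    induction e with | _ v u =>
    have hT : ∀ x, Touched S x ↔ ∃ e' ∈ M, x ∈ e' := by
      intro x
      constructor
      · rintro ⟨y, h | h⟩
        · exact ⟨s(x, y), (hM _ _).2 h, Sym2.mem_mk_left _ _⟩
        · exact ⟨s(y, x), (hM _ _).2 h, Sym2.mem_mk_right _ _⟩
      · rintro ⟨e', h1, h2⟩
        obtain ⟨y, -, h3⟩ := hmem e' h1 x h2
        exact ⟨y, Or.inl h3⟩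
    simp only [unmatchedEdges, Set.mem_sep_iff, SimpleGraph.mem_edgeSet, Sym2.mem_iff,
      forall_eq_or_imp, forall_eq, hT, not_exists, not_and]
  have hcov : coveredEdges X.G M = X.G.edgeSet \ unmatchedEdges X.G M := by
    ext e
    simp only [coveredEdges, unmatchedEdges, Set.mem_sep_iff, Set.mem_sdiff, not_and, not_forall,
      not_not]
    constructor
    · rintro ⟨h1, e', h2, v, h3, h4⟩
      exact ⟨h1, fun _ => ⟨v, h3, e', h2, h4⟩⟩
    · rintro ⟨h1, h2⟩
      obtain ⟨v, h3, e', h4, h5⟩ := h2 h1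
      exact ⟨h1, e', h4, v, h3, h5⟩
  have hunle : ((unmatchedEdges X.G M).ncard : ℝ) ≤ ε * (X.G.edgeSet.ncard : ℝ) := by
    rw [size_eq_two_mul, size_eq_two_mul, ← hun] at hsize
    push_cast at hsize
    linarith
  have hsub : unmatchedEdges X.G M ⊆ X.G.edgeSet := fun e he => he.1
  refine ⟨⟨⟨?_, ?_⟩, ?_⟩, hunle⟩
  · intro e he
    induction e with | _ v u =>
    exact hSG v u ((hM v u).1 he)
  · rintro e he e' he' hne v ⟨h1, h2⟩
    obtain ⟨u, rfl, h3⟩ := hmem e he v h1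
    obtain ⟨w, rfl, h4⟩ := hmem e' he' v h2
    exact hne (by rw [huniq v u w h3 h4])
  · have h1 := Set.ncard_sdiff_add_ncard_of_subset hsub (Set.toFinite _)
    rw [← hcov] at h1
    have h2 : ((coveredEdges X.G M).ncard : ℝ) + (unmatchedEdges X.G M).ncard
        = X.G.edgeSet.ncard := by exact_mod_cast h1
    linarith

/-- The matching computed by the main algorithm, for networks of maximum degree at most `2 ^ K` with
identifiers smaller than `N`, after `J` phases. -/
def solution (X : Net.{u}) (c K J N : ℕ) (v u : X.V) : Prop :=
  X.matchAt K (2 ^ (5 + c + 2 * K)) (2 * (5 + c + 2 * K) + 5)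
    (X.reducedCol X.G.Adj (2 ^ K) (Nat.clog 2 N) (precolourRounds c K N)) J v u ∨
  X.matchAt K (2 ^ (5 + c + 2 * K)) (2 * (5 + c + 2 * K) + 5)
    (X.reducedCol X.G.Adj (2 ^ K) (Nat.clog 2 N) (precolourRounds c K N)) J u v

/-- The number of rounds of the main algorithm. -/
noncomputable def solutionRounds (c K J N : ℕ) : ℕ :=
  precolourRounds c K N + 1 + J * (phaseRounds K (2 * (5 + c + 2 * K) + 5) + 1) + 1

theorem solution_adj {c K J N : ℕ} (v u : X.V) (h : X.solution c K J N v u) : X.G.Adj v u := by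
  rcases h with h | h
  exacts [matchAt_adj _ _ _ h, (matchAt_adj _ _ _ h).symm]

theorem solution_symm {c K J N : ℕ} (v u : X.V) (h : X.solution c K J N v u) :
    X.solution c K J N u v := Or.symm h

theorem relSim_solution (c K J N : ℕ) :
    RelSim X Y (solutionRounds c K J N) (X.solution c K J N) (Y.solution c K J N) := by
  have h1 := funSim_reducedCol (X := X) (Y := Y) (t := 0) relSim_adj (fun _ _ h => h)
    (fun _ _ h => h) (2 ^ K) (Nat.clog 2 N) (precolourRounds c K N)
  have h2 := relSim_matchAt (K := K) (k := 2 ^ (5 + c + 2 * K)) (s := 2 * (5 + c + 2 * K) + 5)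
    (t := precolourRounds c K N) (h1.mono (by omega)) J
  exact (h2.mono (Nat.le_succ _)).or (h2.flip (matchAt_adj J) (matchAt_adj J))

/-- Eleven phases halve the number of uncovered edges, since (15/16)^11 < 1/2. -/
theorem pow_le_of_logb {ε : ℝ} (hε : 0 < ε) :
    (15 / 16 : ℝ) ^ (11 * ⌈Real.logb 2 (1 / ε)⌉₊) ≤ ε := by
  set q := ⌈Real.logb 2 (1 / ε)⌉₊ with hq
  have h1 : 1 / ε ≤ 2 ^ q := by
    rw [← Real.rpow_natCast, ← Real.logb_le_iff_le_rpow (by norm_num) (by positivity)]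
    exact Nat.le_ceil _
  rw [pow_mul]
  calc ((15 / 16 : ℝ) ^ 11) ^ q ≤ (1 / 2) ^ q :=
        pow_le_pow_left₀ (by positivity) (by norm_num) q
    _ = 1 / 2 ^ q := by rw [one_div_pow]
    _ ≤ ε := by
      rw [div_le_iff₀ (by positivity)]
      rw [div_le_iff₀ hε] at h1
      linarith

theorem solution_spec {c K N n : ℕ} {ε : ℝ} (hε : 0 < ε) (hK0 : 1 ≤ K)
    (hK : ∀ v, X.deg v ≤ 2 ^ K) (hcol : X.col = X.ident) (hn : 2 ≤ n) (hN0 : 1 ≤ N)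
    (hN : N ≤ n ^ c) (hid : ∀ v, X.ident v < N) :
    (∀ v u w, X.solution c K (11 * ⌈Real.logb 2 (1 / ε)⌉₊) N v u →
      X.solution c K (11 * ⌈Real.logb 2 (1 / ε)⌉₊) N v w → u = w) ∧
    ((X.prune (X.solution c K (11 * ⌈Real.logb 2 (1 / ε)⌉₊) N) X.col).size : ℝ) ≤ ε * X.size := by
  classical
  set J := 11 * ⌈Real.logb 2 (1 / ε)⌉₊ with hJ
  obtain ⟨h1, h2⟩ := reducedCol_spec (X := X) (Q := X.G.Adj) (d := 2 ^ K) (k := Nat.clog 2 N)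
    (fun v => by rw [← deg_eq]; exact hK v)
    (fun v => by
      rw [hcol]
      exact (hid v).trans_le (Nat.le_pow_clog (by norm_num) _))
    (fun v u h => by
      rw [hcol]
      exact fun h3 => h.ne (X.ident_injective h3)) (precolourRounds c K N)
  have h3 := (precolourRounds_spec (K := K) hn hN0 hN).2
  obtain ⟨h4, h5⟩ := matchAt_spec (X := X) (K := K) (k := 2 ^ (5 + c + 2 * K)) hK0
    (fun v => Nat.clog_le_of_le_pow (hK v))
    (fun v => (h1 v).trans_le (Nat.pow_le_pow_right (by norm_num) h3)) h2
    (iterate_nextBits_two_pow_le (5 + c + 2 * K)) J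
  set M := X.matchAt K (2 ^ (5 + c + 2 * K)) (2 * (5 + c + 2 * K) + 5)
    (X.reducedCol X.G.Adj (2 ^ K) (Nat.clog 2 N) (precolourRounds c K N)) J with hM
  refine ⟨?_, ?_⟩
  · rintro v u w (h | h) (h' | h')
    · exact (h4 _ _ _ _ h h' (Or.inl rfl)).2
    · obtain ⟨rfl, rfl⟩ := h4 _ _ _ _ h h' (Or.inr (Or.inl rfl))
      rfl
    · obtain ⟨rfl, rfl⟩ := h4 _ _ _ _ h h' (Or.inr (Or.inr (Or.inl rfl)))
      rfl
    · exact (h4 _ _ _ _ h h' (Or.inr (Or.inr (Or.inr rfl)))).1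
  · have hT : ∀ x, Touched (X.solution c K J N) x ↔ Touched M x := by
      intro x
      constructor
      · rintro ⟨y, (h | h) | (h | h)⟩
        exacts [⟨y, Or.inl h⟩, ⟨y, Or.inr h⟩, ⟨y, Or.inr h⟩, ⟨y, Or.inl h⟩]
      · rintro ⟨y, h | h⟩
        exacts [⟨y, Or.inl (Or.inl h)⟩, ⟨y, Or.inl (Or.inr h)⟩]
    have h6 : (X.prune (X.solution c K J N) X.col).size = (X.prune M
        (X.reducedCol X.G.Adj (2 ^ K) (Nat.clog 2 N) (precolourRounds c K N))).size := by
      simp only [size]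
      congr 1
      ext e
      simp only [hT, Finset.mem_filter]
    rw [h6]
    set s' := (X.prune M
        (X.reducedCol X.G.Adj (2 ^ K) (Nat.clog 2 N) (precolourRounds c K N))).size
    have h7 : (16 : ℝ) ^ J * s' ≤ 15 ^ J * X.size := by exact_mod_cast h5
    have h8 := pow_le_of_logb hε
    rw [← hJ, div_pow, div_le_iff₀ (by positivity)] at h8
    have h9 : (16 : ℝ) ^ J * s' ≤ 16 ^ J * (ε * X.size) := by
      calc _ ≤ _ := h7
        _ ≤ ε * 16 ^ J * X.size := mul_le_mul_of_nonneg_right h8 (Nat.cast_nonneg _)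
        _ = _ := by ring
    exact le_of_mul_le_mul_left h9 (by positivity)

/-- A phase takes at most (2100 + 2c)K² rounds, K² ≤ 4a⁴L², and there are 11q phases. The two rounds
outside the phases and the colouring are absorbed by 3 · log* n, as log* n ≥ 1. -/
theorem solutionRounds_le {a L : ℝ} (ha : 1 ≤ a) (hL : 1 ≤ L) {c K q N n : ℕ} (hK0 : 1 ≤ K)
    (hKL : (K : ℝ) ≤ a ^ 2 * L + 1) (hn : 2 ≤ n) (hN0 : 1 ≤ N) (hN : N ≤ n ^ c) :
    (solutionRounds c K (11 * q) N : ℝ)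
      ≤ (3 + 44 * a ^ 4 * (2100 + 2 * c)) * (L ^ 2 * q + (logStar n : ℝ)) := by
  have h1 : (precolourRounds c K N : ℝ) ≤ logStar n := by
    exact_mod_cast (precolourRounds_spec (K := K) hn hN0 hN).1
  have h2 : (1 : ℝ) ≤ logStar n := by
    exact_mod_cast one_le_logStar (x := n) (by exact_mod_cast hn)
  have hK0' : (1 : ℝ) ≤ K := by exact_mod_cast hK0
  have h3 : ((phaseRounds K (2 * (5 + c + 2 * K) + 5) + 1 : ℕ) : ℝ)
      ≤ (2100 + 2 * c) * (K : ℝ) ^ 2 := by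
    rw [phaseRounds]
    push_cast
    nlinarith [mul_nonneg (Nat.cast_nonneg c : (0 : ℝ) ≤ c)
      (by nlinarith : (0 : ℝ) ≤ (K : ℝ) ^ 2 - 1)]
  have ha2 : 1 ≤ a ^ 2 := one_le_pow₀ ha
  have h4 : (K : ℝ) ≤ 2 * (a ^ 2 * L) := by nlinarith
  have h5 : (K : ℝ) ^ 2 ≤ 4 * a ^ 4 * L ^ 2 := by
    calc (K : ℝ) ^ 2 ≤ (2 * (a ^ 2 * L)) ^ 2 := pow_le_pow_left₀ (by linarith) h4 2
      _ = _ := by ring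
  have h6 : ((phaseRounds K (2 * (5 + c + 2 * K) + 5) + 1 : ℕ) : ℝ)
      ≤ (2100 + 2 * c) * (4 * a ^ 4 * L ^ 2) :=
    h3.trans (mul_le_mul_of_nonneg_left h5 (by positivity))
  have h7 : (solutionRounds c K (11 * q) N : ℝ) = precolourRounds c K N + 2
      + 11 * q * ((phaseRounds K (2 * (5 + c + 2 * K) + 5) + 1 : ℕ) : ℝ) := by
    rw [solutionRounds]
    push_cast
    ring
  have h8 : 11 * (q : ℝ) * ((phaseRounds K (2 * (5 + c + 2 * K) + 5) + 1 : ℕ) : ℝ)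
      ≤ 44 * a ^ 4 * (2100 + 2 * c) * (L ^ 2 * q) := by
    calc _ ≤ 11 * (q : ℝ) * ((2100 + 2 * c) * (4 * a ^ 4 * L ^ 2)) :=
          mul_le_mul_of_nonneg_left h6 (by positivity)
      _ = _ := by ring
  rw [h7]
  have h9 : 0 ≤ L ^ 2 * q := by positivity
  have h10 : 0 ≤ 44 * a ^ 4 * (2100 + 2 * (c : ℝ)) := by positivity
  nlinarith [mul_nonneg h10 (by linarith : (0 : ℝ) ≤ logStar (n : ℝ))]

end Net

/-! ### Degenerate inputs and conclusion -/

theorem theorem3 (a : ℝ) (ha : 1 ≤ a) (c : ℕ) :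
    ∃ C : ℝ, 0 < C ∧ ∀ ε : ℝ, 0 < ε → ∃ A : LocalAlgorithm (Finset ℕ),
      ∀ (V : Type*) [Fintype V] (G : SimpleGraph V) [DecidableRel G.Adj]
        (ident : V → ℕ) (N : ℕ) (ℓ : ℝ),
        Function.Injective ident → (∀ v, ident v < N) → N ≤ Fintype.card V ^ c →
        Real.logb 2 (G.maxDegree : ℝ) ≤ a * ℓ → ℓ ≤ a * Real.logb 2 (G.maxDegree : ℝ) →
        ∃ (T : ℕ) (M : Set (Sym2 V)),
          (T : ℝ) ≤ C * ((Real.logb 2 (G.maxDegree : ℝ)) ^ 2 * (⌈Real.logb 2 (1 / ε)⌉₊ : ℝ)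
            + (logStar (Fintype.card V : ℝ) : ℝ)) ∧
          A.ComputesEdgesWithin G ident N ℓ T M ∧
          IsEpsMaximalMatching G ε M ∧
          ((unmatchedEdges G M).ncard : ℝ) ≤ ε * (G.edgeSet.ncard : ℝ) := by
  classical
  have hC : 0 < 3 + 44 * a ^ 4 * (2100 + 2 * (c : ℝ)) := by positivity
  refine ⟨_, hC, fun ε hε => ?_⟩
  let J : ℕ := 11 * ⌈Real.logb 2 (1 / ε)⌉₊
  -- If `N ≤ 1` there are no edges, and if `1 ≤ ε` the empty matching suffices. If `ℓ ≤ 0` the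
  -- maximum degree is at most 1, so all edges form a matching, found in one round. Otherwise `K =
  -- ⌈a * ℓ⌉₊` is positive and bounds log₂ Δ from above, as the main algorithm requires.
  let T : ℕ → ℝ → ℕ := fun N ℓ =>
    if N ≤ 1 ∨ 1 ≤ ε then 0 else if ℓ ≤ 0 then 1 else Net.solutionRounds c ⌈a * ℓ⌉₊ J N
  let S : ℕ → ℝ → ∀ X : Net, X.V → X.V → Prop := fun N ℓ X v u =>
    if N ≤ 1 ∨ 1 ≤ ε then False else if ℓ ≤ 0 then X.G.Adj v u
      else X.solution c ⌈a * ℓ⌉₊ J N v u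
  obtain ⟨A, hA⟩ := exists_algorithm T (fun N ℓ X => X.outIds (S N ℓ X)) (by
    intro N ℓ X Y
    by_cases h1 : N ≤ 1 ∨ 1 ≤ ε
    · intro v v' _
      ext i
      simp only [Net.mem_outIds, S, if_pos h1, false_and, exists_false]
    · by_cases h2 : ℓ ≤ 0
      · simp only [T, S, h1, h2, if_true, if_false]
        exact Net.RelSim.funSim_outIds Net.relSim_adj (fun _ _ h => h) (fun _ _ h => h)
      · simp only [T, S, h1, h2, if_false]
        exact Net.RelSim.funSim_outIds (Net.relSim_solution _ _ _ _) Net.solution_adj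
          Net.solution_adj)
  refine ⟨A, ?_⟩
  intro V _ G _ ident N ℓ hinj hid hN hℓ hℓ'
  let X : Net := ⟨V, inferInstance, G, ident, hinj, ident⟩
  have hsymm : Std.Symm (S N ℓ X) := ⟨fun v u h => by
    simp only [S] at h ⊢
    split_ifs at h ⊢
    · exact h.symm
    · exact Net.solution_symm v u h⟩
  have hSG : ∀ v u, S N ℓ X v u → X.G.Adj v u := fun v u h => by
    simp only [S] at h
    split_ifs at h
    · exact h
    · exact Net.solution_adj v u h
  have hdeg : ∀ v, X.deg v ≤ G.maxDegree := fun v => by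
    rw [Net.deg_eq_degree (X := X)]
    exact G.degree_le_maxDegree v
  have key : (T N ℓ : ℝ) ≤ (3 + 44 * a ^ 4 * (2100 + 2 * (c : ℝ)))
      * ((Real.logb 2 (G.maxDegree : ℝ)) ^ 2 * (⌈Real.logb 2 (1 / ε)⌉₊ : ℝ)
            + (logStar (Fintype.card V : ℝ) : ℝ)) ∧
      (∀ v u w, S N ℓ X v u → S N ℓ X v w → u = w) ∧
      ((X.prune (S N ℓ X) X.col).size : ℝ) ≤ ε * X.size := by
    by_cases h1 : N ≤ 1 ∨ 1 ≤ ε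
    · have hSF : ∀ v u, ¬ S N ℓ X v u := fun v u h => by simp only [S, if_pos h1] at h
      refine ⟨?_, fun v u w h => absurd h (hSF v u), ?_⟩
      · simp only [T, h1, if_true, Nat.cast_zero]
        positivity
      · have h2 : (X.prune (S N ℓ X) X.col).size ≤ X.size :=
          (Nat.le_add_right _ _).trans (Net.size_prune_add_le _ _)
        rcases h1 with h1 | h1
        · have h3 : X.size = 0 := by
            refine Net.size_eq_zero fun v u h => h.ne (hinj ?_)
            have h4 := hid v
            have h5 := hid u
            omega
          rw [h3] at h2 ⊢
          simp only [Nat.cast_zero, mul_zero]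
          exact_mod_cast h2
        · have h3 : ((X.prune (S N ℓ X) X.col).size : ℝ) ≤ X.size := by exact_mod_cast h2
          nlinarith [(Nat.cast_nonneg X.size : (0 : ℝ) ≤ X.size)]
    obtain ⟨hN1, hε1⟩ := not_or.1 h1
    have hn : 2 ≤ Fintype.card V := by
      by_contra hn
      have h2 : Fintype.card V ^ c ≤ 1 := by
        calc Fintype.card V ^ c ≤ 1 ^ c := Nat.pow_le_pow_left (by omega) c
          _ = 1 := one_pow c
      omega
    by_cases h2 : ℓ ≤ 0
    · have hSA : S N ℓ X = X.G.Adj := by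
        funext v u
        simp only [S, h1, h2, if_true, if_false]
      have hΔ : G.maxDegree ≤ 1 := by
        by_contra hΔ
        have h3 : (1 : ℝ) < G.maxDegree := by exact_mod_cast not_le.1 hΔ
        have h4 := Real.logb_pos (b := 2) (by norm_num) h3
        nlinarith
      refine ⟨?_, ?_, ?_⟩
      · simp only [T, h1, h2, if_true, if_false, Nat.cast_one]
        have h3 : (1 : ℝ) ≤ logStar (Fintype.card V : ℝ) := by
          exact_mod_cast one_le_logStar (x := Fintype.card V) (by exact_mod_cast hn)
        have h4 : 0 ≤ 44 * a ^ 4 * (2100 + 2 * (c : ℝ)) := by positivity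
        have h5 : 0 ≤ (Real.logb 2 (G.maxDegree : ℝ)) ^ 2 * (⌈Real.logb 2 (1 / ε)⌉₊ : ℝ) := by
          positivity
        nlinarith [mul_nonneg h4 h5, mul_nonneg h4 (by linarith : (0 : ℝ) ≤
          logStar (Fintype.card V : ℝ))]
      · intro v u w h h'
        rw [hSA] at h h'
        have h3 := (hdeg v).trans hΔ
        rw [Net.deg_eq] at h3
        exact Finset.card_le_one.1 h3 u (by simpa using h) w (by simpa using h')
      · have h3 : (X.prune (S N ℓ X) X.col).size = 0 := by
          refine Net.size_eq_zero fun v u h => h.2.1 ⟨u, Or.inl ?_⟩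
          rw [hSA]
          exact h.1
        rw [h3]
        simp only [Nat.cast_zero]
        positivity
    · have hℓ0 : 0 < ℓ := not_le.1 h2
      set L := Real.logb 2 (G.maxDegree : ℝ) with hL
      have hL0 : 0 < L := by
        by_contra hneg
        nlinarith [not_lt.1 hneg]
      have hΔ : 2 ≤ G.maxDegree := by
        by_contra hΔ
        have h3 : G.maxDegree = 0 ∨ G.maxDegree = 1 := by omega
        rcases h3 with h3 | h3 <;> simp [hL, h3] at hL0
      have hL1 : 1 ≤ L := by
        rw [hL, Real.le_logb_iff_rpow_le (by norm_num) (by positivity), Real.rpow_one]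
        exact_mod_cast hΔ
      have haℓ : 0 < a * ℓ := by positivity
      have hK0 : 1 ≤ ⌈a * ℓ⌉₊ := Nat.one_le_ceil_iff.2 haℓ
      have hK : ∀ v, X.deg v ≤ 2 ^ ⌈a * ℓ⌉₊ := by
        intro v
        refine (hdeg v).trans ?_
        have h3 : L ≤ (⌈a * ℓ⌉₊ : ℝ) := hℓ.trans (Nat.le_ceil _)
        rw [hL, Real.logb_le_iff_le_rpow (by norm_num) (by positivity), Real.rpow_natCast] at h3
        exact_mod_cast h3
      have hKL : (⌈a * ℓ⌉₊ : ℝ) ≤ a ^ 2 * L + 1 := by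
        refine (Nat.ceil_lt_add_one haℓ.le).le.trans ?_
        nlinarith [mul_le_mul_of_nonneg_left hℓ' (by linarith : (0 : ℝ) ≤ a)]
      have hS : S N ℓ X = X.solution c ⌈a * ℓ⌉₊ J N := by
        funext v u
        simp only [S, h1, h2, if_false]
      rw [hS]
      refine ⟨?_, Net.solution_spec hε hK0 hK rfl hn (by omega) hN hid⟩
      simp only [T, h1, h2, if_false]
      exact Net.solutionRounds_le ha hL1 hK0 hKL hn (by omega) hN
  obtain ⟨hT, huniq, hsize⟩ := key
  refine ⟨T N ℓ, Sym2.fromRel hsymm, hT, fun v => ⟨_, hA X N ℓ rfl v, fun i => ?_⟩,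
    Net.isEpsMaximalMatching_of_size (X := X) hSG huniq hsize _ fun v u => Sym2.fromRel_prop⟩
  simp only [Net.mem_outIds, Sym2.fromRel_prop]
  rfl
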